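/- Let $F$ be a Finsler metric on a smooth manifold $M$, i.e. $F:TM\to[0,\infty)$ is smooth on $TM\setminus 0$, vanishes exactly on the zero section, is positively $1$-homogeneous on fibres, and has positive-definite fundamental tensor $g_w(u,v)=\tfrac12\partial_t\partial_s|_{0}F(w+su+tv)^2$ for $w\ne0$. Let $\mathrm C_w(u,v,z)=\tfrac14\partial_r\partial_s\partial_t|_{0}F(w+ru+sv+tz)^2$ be its Cartan tensor. Write $\pi:TM\setminus0\to M$, $\mathscr VTM=\ker d\pi$, $i_w:T_{\pi(w)}M\to\mathscr V_wTM$ for the vertical lift, $C(w)=i_w(w)$ and $\mathscr J(X)=i_w(d\pi X)$. Let $S$ be the geodesic spray of $F$: the second order differential equation ($\mathscr J(S)=C$) with $d(\tfrac12F^2)=\omega_F(S,\cdot)$, where $\omega_F$ is the pull-back of the canonical symplectic form of $T^*M$ by $w\mapsto g_w(w,\cdot)$. Let $\Gamma_S=-[S,\mathscr J]$, i.e. $\Gamma_S(X)=\mathscr J[S,X]-[S,\mathscr JX]$, $\mathscr HX=\frac12(X+\Gamma_SX)$, $\mathscr VX=\frac12(X-\Gamma_SX)$. A lift of $\Gamma_S$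 is a linear connection $\nabla$ on the vector bundle $\mathscr VTM\to TM\setminus0$ with $\nabla_XC=\mathscr VX$ for all $X$. Its torsion is $\mathrm T(X,Y)=\nabla_X\mathscr JY-\nabla_Y\mathscr JX-\mathscr J[X,Y]$. The family of affine connections corresponding to $\nabla$ consists, for each open $\mathcal O\subseteq M$ and each nowhere null smooth vector field $W$ on $\mathcal O$, of the affine connection $D^W$ on $\mathcal O$ given by $D^W_uV=i_w^{-1}\nabla_{u^{\mathfrak h}}V^{\mathfrak v}$ for $u\in T_xM$, $x\in\mathcal O$, where $w=W(x)$, $u^{\mathfrak h}$ is the horizontal lift of $u$ at $w$ and $V^{\mathfrak v}$ the vertical lift of $V$. Let $\mathrm C'_w(u,v,z)=(D^W_W\mathrm C_W)(u,v,z)$, where $D^W$ comes from any lift of $\Gamma_S$ with $\mathrm T(S,\cdot)=0$, and $W$ is any nowhere null extension of $w$ whose integral curve through $\pi(w)$ is a geodesic (this does not depend on the choices). Transport $g$, $\mathrm C$, $\mathrm C'$ to $\mathscr VTM$ by the vertical lift. The four classical connections of $F$ are the lifts $\nabla$ of $\Gamma_S$ characterized by the following conditions, for all vector fields $X,Y,Z$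 on $TM\setminus 0$: * Cartan: $\mathrm T(\mathscr HX,\mathscr HY)=0$, $\nabla g=0$, and $g(\mathrm T(\mathscr JX,Y),\mathscr JZ)=g(\mathrm T(\mathscr JX,Z),\mathscr JY)$; * Chern–Rund: $\mathrm T=0$ and $(\nabla_Xg)(\cdot,\cdot)=2\mathrm C(\mathscr VX,\cdot,\cdot)$; * Berwald: $\mathrm T=0$ and $(\nabla_Xg)(\cdot,\cdot)=2\mathrm C(\mathscr VX,\cdot,\cdot)-2\mathrm C'(\mathscr JX,\cdot,\cdot)$; * Hashiguchi: $\mathrm T(\mathscr HX,\mathscr HY)=0$, $(\nabla_Xg)(\cdot,\cdot)=-2\mathrm C'(\mathscr JX,\cdot,\cdot)$, and $g(\mathrm T(\mathscr JX,Y),\mathscr JZ)=g(\mathrm T(\mathscr JX,Z),\mathscr JY)$. **Theorem.** Let $\mathcal O\subseteq M$ be open and let $W$ be a nowhere null smooth vector field on $\mathcal O$. Below, $U,V,T$ are arbitrary smooth vector fields on $\mathcal O$. 1. If $\nabla$ is the Cartan or the Chern–Rund connection, then $D^W$ is an affine connection on $\mathcal O$ satisfying $$D^W_UV-D^W_VU=[U,V],\qquad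 (D^W_Ug_W)(T,V)=2\mathrm C_W(D^W_UW,T,V).$$ 2. If $\nabla$ is the Berwald or the Hashiguchi connection, then $D^W$ is an affine connection on $\mathcal O$ satisfying $$D^W_UV-D^W_VU=[U,V],\qquad (D^W_Ug_W)(T,V)=2\mathrm C_W(D^W_UW,T,V)-2\mathrm C'_W(U,T,V).$$ 3. Each of these two sets of properties determines the family uniquely: two affine connections on $\mathcal O$ that both satisfy the properties in 1 (with the same $W$) are equal, and likewise for the properties in 2. 4. Consequently the Cartan and Chern–Rund families coincide, and the Berwald and Hashiguchi families coincide. -/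

import Mathlib

open Bundle Set
open scoped Manifold ContDiff Topology

noncomputable section

namespace Finsler

/-! ### Smooth vector fields and the slit tangent bundle -/

section Fields

variable {V : Type*} [NormedAddCommGroup V] [NormedSpace ℝ V]
  {H : Type*} [TopologicalSpace H] (I : ModelWithCorners ℝ V H)
  {N : Type*} [TopologicalSpace N] [ChartedSpace H N] [IsManifold I ∞ N]

/-- The vector field `X` is smooth on the set `U`. -/
def SmoothFieldOn (X : Π x : N, TangentSpace I x) (U : Set N) : Prop :=
  ContMDiffOn I I.tangent ∞ (fun x => (⟨x, X x⟩ : TangentBundle I N)) U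

/-- `ξ(f)`: the derivative at `x` of the real function `f` in the direction `ξ ∈ T_x N`. -/
def dirDeriv (f : N → ℝ) (x : N) (ξ : TangentSpace I x) : ℝ := mvfderiv I f x ξ

end Fields

variable {E : Type*} [NormedAddCommGroup E] [NormedSpace ℝ E]
  {M : Type*} [TopologicalSpace M] [ChartedSpace E M] [IsManifold 𝓘(ℝ, E) ∞ M]

variable (E M) in
/-- The slit tangent bundle `TM \ 0`, as a subset of `TM`. -/
def slit : Set (TangentBundle 𝓘(ℝ, E) M) := {w | w.2 ≠ 0}

/-- A vector field `w ↦ X w ∈ T_w(TM)` on the tangent bundle (only its values on `TM \ 0` will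
matter). -/
abbrev FieldTM (E M : Type*) [NormedAddCommGroup E] [NormedSpace ℝ E]
    [TopologicalSpace M] [ChartedSpace E M] [IsManifold 𝓘(ℝ, E) ∞ M] :=
  Π w : TangentBundle 𝓘(ℝ, E) M, TangentSpace 𝓘(ℝ, E).tangent w

/-- A field `w ↦ Y w ∈ T_{π(w)} M` along the projection `π : TM → M`. Since the vertical lift
`i_w : T_{π(w)} M → V_w TM` is an isomorphism, these fields are the same thing as the sections
`w ↦ i_w (Y w)` of the vertical bundle `VTM`, and they are used to represent them. -/
abbrev VertSection (E M : Type*) [NormedAddCommGroup E] [NormedSpace ℝ E]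
    [TopologicalSpace M] [ChartedSpace E M] [IsManifold 𝓘(ℝ, E) ∞ M] :=
  Π w : TangentBundle 𝓘(ℝ, E) M, TangentSpace 𝓘(ℝ, E) w.proj

/-- The map `TM → TM` underlying a section of the vertical bundle. -/
def VertSection.toMap (Y : VertSection E M) :
    TangentBundle 𝓘(ℝ, E) M → TangentBundle 𝓘(ℝ, E) M := fun w => ⟨w.proj, Y w⟩

/-- Smoothness on `U` of a section of the vertical bundle. -/
def VertSection.SmoothOn (Y : VertSection E M) (U : Set (TangentBundle 𝓘(ℝ, E) M)) : Prop :=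
  ContMDiffOn 𝓘(ℝ, E).tangent 𝓘(ℝ, E).tangent ∞ Y.toMap U

/-- Differentiability at `w` of a section of the vertical bundle. -/
def VertSection.DiffAt (Y : VertSection E M) (w : TangentBundle 𝓘(ℝ, E) M) : Prop :=
  MDifferentiableAt 𝓘(ℝ, E).tangent 𝓘(ℝ, E).tangent Y.toMap w

/-- The differential `dπ(w) : T_w(TM) → T_{π(w)} M` of the projection. -/
def dproj (w : TangentBundle 𝓘(ℝ, E) M) :
    TangentSpace 𝓘(ℝ, E).tangent w →L[ℝ] TangentSpace 𝓘(ℝ, E) w.proj :=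
  mfderiv 𝓘(ℝ, E).tangent 𝓘(ℝ, E)
    (fun z : TangentBundle 𝓘(ℝ, E) M => z.proj) w

/-- The vertical lift `i_w(u) = (d/dt)|_{t=0} (w + t u)`. -/
def vlift (w : TangentBundle 𝓘(ℝ, E) M) (u : TangentSpace 𝓘(ℝ, E) w.proj) :
    TangentSpace 𝓘(ℝ, E).tangent w :=
  mfderiv 𝓘(ℝ, ℝ) 𝓘(ℝ, E).tangent
    (fun t : ℝ => (⟨w.proj, w.2 + t • u⟩ : TangentBundle 𝓘(ℝ, E) M)) 0 (1 : ℝ)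

/-- The inverse `i_w⁻¹ : V_w TM → T_{π(w)} M` of the vertical lift. -/
def vliftInv (w : TangentBundle 𝓘(ℝ, E) M) (ξ : TangentSpace 𝓘(ℝ, E).tangent w) :
    TangentSpace 𝓘(ℝ, E) w.proj :=
  Function.invFun (vlift w) ξ

/-- The canonical vector field `C(w) = i_w(w)`, as a section of the vertical bundle. -/
def canon : VertSection E M := fun w => w.2

/-- The almost-tangent structure `J(X) = i_w(dπ(X))`. -/
def almostTangent (X : FieldTM E M) : FieldTM E M := fun w => vlift w (dproj w (X w))

/-- `J(X)` as a section of the vertical bundle, that is, `w ↦ dπ(X w)`. -/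
def projField (X : FieldTM E M) : VertSection E M := fun w => dproj w (X w)

/-- The vertical lift of a vector field `V` on `M`, as a section of the vertical bundle. -/
def pullField (V : Π x : M, TangentSpace 𝓘(ℝ, E) x) : VertSection E M := fun w => V w.proj

/-! ### The canonical connection of a spray -/

/-- `Γ_S = -[S, J]`, that is, `Γ_S(X) = J[S, X] - [S, JX]`. -/
def grifone (S X : FieldTM E M) : FieldTM E M := fun w =>
  almostTangent (VectorField.mlieBracket 𝓘(ℝ, E).tangent S X) w
    - VectorField.mlieBracket 𝓘(ℝ, E).tangent S (almostTangent X) w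

/-- The horizontal part `HX = (X + Γ_S X) / 2` of a vector field. -/
def horPart (S X : FieldTM E M) : FieldTM E M := fun w => (2⁻¹ : ℝ) • (X w + grifone S X w)

/-- The vertical part `VX = (X - Γ_S X) / 2` of a vector field. -/
def verPart (S X : FieldTM E M) : FieldTM E M := fun w => (2⁻¹ : ℝ) • (X w - grifone S X w)

/-- The vector `h ∈ T_w(TM)` belongs to `ker (Γ_S - Id)`. -/
def IsHorizontal (S : FieldTM E M) (w : TangentBundle 𝓘(ℝ, E) M)
    (h : TangentSpace 𝓘(ℝ, E).tangent w) : Prop :=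
  ∃ (U : Set (TangentBundle 𝓘(ℝ, E) M)) (X : FieldTM E M), IsOpen U ∧ U ⊆ slit E M ∧ w ∈ U ∧
    SmoothFieldOn 𝓘(ℝ, E).tangent X U ∧ X w = h ∧ grifone S X w = h

/-- The horizontal lift `u ↦ u^h` at `w`: the linear map `T_{π(w)} M → T_w(TM)` such that `u^h` is
horizontal and `dπ(u^h) = u`. -/
def hlift (S : FieldTM E M) (w : TangentBundle 𝓘(ℝ, E) M) :
    TangentSpace 𝓘(ℝ, E) w.proj →L[ℝ] TangentSpace 𝓘(ℝ, E).tangent w :=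
  Classical.epsilon fun L => ∀ u, dproj w (L u) = u ∧ IsHorizontal S w (L u)

/-! ### Linear connections on the vertical bundle -/

/-- The type of operators `∇`, with `∇ Y w ξ` standing for `∇_ξ Y` at `w`; as in Mathlib, the
dependence on the direction `ξ ∈ T_w(TM)` is linear by construction. -/
abbrev VertOperator (E M : Type*) [NormedAddCommGroup E] [NormedSpace ℝ E]
    [TopologicalSpace M] [ChartedSpace E M] [IsManifold 𝓘(ℝ, E) ∞ M] :=
  VertSection E M → Π w : TangentBundle 𝓘(ℝ, E) M,
    (TangentSpace 𝓘(ℝ, E).tangent w →L[ℝ] TangentSpace 𝓘(ℝ, E) w.proj)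

/-- `∇` is a (smooth) linear connection on the vertical bundle `VTM → TM \ 0`. -/
structure IsVertConnection (nabla : VertOperator E M) : Prop where
  add : ∀ (Y Y' : VertSection E M) (w : TangentBundle 𝓘(ℝ, E) M), w ∈ slit E M →
    Y.DiffAt w → Y'.DiffAt w → nabla (Y + Y') w = nabla Y w + nabla Y' w
  leibniz : ∀ (f : TangentBundle 𝓘(ℝ, E) M → ℝ) (Y : VertSection E M)
    (w : TangentBundle 𝓘(ℝ, E) M), w ∈ slit E M →
    MDifferentiableAt 𝓘(ℝ, E).tangent 𝓘(ℝ, ℝ) f w → Y.DiffAt w →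
    ∀ ξ : TangentSpace 𝓘(ℝ, E).tangent w,
      nabla (fun z => f z • Y z) w ξ
        = f w • nabla Y w ξ + dirDeriv 𝓘(ℝ, E).tangent f w ξ • Y w
  smooth : ∀ (U : Set (TangentBundle 𝓘(ℝ, E) M)) (X : FieldTM E M) (Y : VertSection E M),
    IsOpen U → U ⊆ slit E M → SmoothFieldOn 𝓘(ℝ, E).tangent X U → Y.SmoothOn U →
    VertSection.SmoothOn (fun w => nabla Y w (X w)) U

/-- `∇` is a lift of `Γ_S`: `∇_X C = VX` for all `X`. -/
structure IsLift (S : FieldTM E M) (nabla : VertOperator E M) : Prop where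
  connection : IsVertConnection nabla
  nabla_canon : ∀ (U : Set (TangentBundle 𝓘(ℝ, E) M)) (X : FieldTM E M), IsOpen U →
    U ⊆ slit E M → SmoothFieldOn 𝓘(ℝ, E).tangent X U →
    ∀ w ∈ U, vlift w (nabla canon w (X w)) = verPart S X w

/-- The torsion `T(X, Y) = ∇_X J(Y) - ∇_Y J(X) - J[X, Y]`, as a section of the vertical bundle. -/
def torsion (nabla : VertOperator E M) (X Y : FieldTM E M) : VertSection E M := fun w =>
  nabla (projField Y) w (X w) - nabla (projField X) w (Y w)
    - dproj w (VectorField.mlieBracket 𝓘(ℝ, E).tangent X Y w)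

/-- `T(S, Y) = 0` for all `Y`. -/
def T1 (S : FieldTM E M) (nabla : VertOperator E M) : Prop :=
  ∀ (U : Set (TangentBundle 𝓘(ℝ, E) M)) (Y : FieldTM E M), IsOpen U → U ⊆ slit E M →
    SmoothFieldOn 𝓘(ℝ, E).tangent Y U → ∀ w ∈ U, torsion nabla S Y w = 0

/-- `T(HX, HY) = 0` for all `X, Y`. -/
def T2 (S : FieldTM E M) (nabla : VertOperator E M) : Prop :=
  ∀ (U : Set (TangentBundle 𝓘(ℝ, E) M)) (X Y : FieldTM E M), IsOpen U → U ⊆ slit E M →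
    SmoothFieldOn 𝓘(ℝ, E).tangent X U → SmoothFieldOn 𝓘(ℝ, E).tangent Y U →
    ∀ w ∈ U, torsion nabla (horPart S X) (horPart S Y) w = 0

/-- `T(X, Y) = 0` for all `X, Y`. -/
def T3 (nabla : VertOperator E M) : Prop :=
  ∀ (U : Set (TangentBundle 𝓘(ℝ, E) M)) (X Y : FieldTM E M), IsOpen U → U ⊆ slit E M →
    SmoothFieldOn 𝓘(ℝ, E).tangent X U → SmoothFieldOn 𝓘(ℝ, E).tangent Y U →
    ∀ w ∈ U, torsion nabla X Y w = 0

/-! ### Affine connections, and the family associated with a lift -/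

/-- The type of operators `D`, with `D V x u` standing for `D_u V` at `x`. -/
abbrev AffineOperator (E M : Type*) [NormedAddCommGroup E] [NormedSpace ℝ E]
    [TopologicalSpace M] [ChartedSpace E M] [IsManifold 𝓘(ℝ, E) ∞ M] :=
  (Π x : M, TangentSpace 𝓘(ℝ, E) x) →
    Π x : M, (TangentSpace 𝓘(ℝ, E) x →L[ℝ] TangentSpace 𝓘(ℝ, E) x)

/-- `D` is a smooth affine connection on the open set `O`. -/
structure IsAffineConnectionOn (O : Set M) (D : AffineOperator E M) : Prop where
  isCovariantDerivativeOn :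
    IsCovariantDerivativeOn E (I := 𝓘(ℝ, E)) (V := fun x : M => TangentSpace 𝓘(ℝ, E) x) D O
  smooth : ∀ (O' : Set M) (U V : Π x : M, TangentSpace 𝓘(ℝ, E) x), IsOpen O' → O' ⊆ O →
    SmoothFieldOn 𝓘(ℝ, E) U O' → SmoothFieldOn 𝓘(ℝ, E) V O' →
    SmoothFieldOn 𝓘(ℝ, E) (fun x => D V x (U x)) O'

/-- The affine connection `D^W` of the family corresponding to `∇`: for `w = W x`,
`D^W_u V = D^w_u V = i_w⁻¹ ∇_{u^h} V^v`, where `u^h` is the horizontal lift of `u` at `w` and `V^v`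
is the vertical lift of `V`. -/
def affineFamily (S : FieldTM E M) (nabla : VertOperator E M)
    (W : Π x : M, TangentSpace 𝓘(ℝ, E) x) : AffineOperator E M := fun V x =>
  (nabla (pullField V) ⟨x, W x⟩).comp (hlift S ⟨x, W x⟩)

/-- `D_U V - D_V U = [U, V]` on `O`. -/
def IsTorsionFreeOn (O : Set M) (D : AffineOperator E M) : Prop :=
  ∀ U V : Π x : M, TangentSpace 𝓘(ℝ, E) x,
    SmoothFieldOn 𝓘(ℝ, E) U O → SmoothFieldOn 𝓘(ℝ, E) V O →
    ∀ x ∈ O, D V x (U x) - D U x (V x) = VectorField.mlieBracket 𝓘(ℝ, E) U V x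

/-! ### Finsler metrics -/

/-- The fundamental tensor `g_w(u, v) = (1/2) ∂²/∂t∂s|₀ F(w + s u + t v)²`. -/
def fundTensor (F : TangentBundle 𝓘(ℝ, E) M → ℝ) (w : TangentBundle 𝓘(ℝ, E) M)
    (u v : TangentSpace 𝓘(ℝ, E) w.proj) : ℝ :=
  (1 / 2 : ℝ) * deriv (fun t : ℝ => deriv (fun s : ℝ =>
    F ⟨w.proj, w.2 + s • u + t • v⟩ ^ 2) 0) 0

/-- The Cartan tensor `C_w(u, v, z) = (1/4) ∂³/∂r∂s∂t|₀ F(w + r u + s v + t z)²`. -/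
def cartanTensor (F : TangentBundle 𝓘(ℝ, E) M → ℝ) (w : TangentBundle 𝓘(ℝ, E) M)
    (u v z : TangentSpace 𝓘(ℝ, E) w.proj) : ℝ :=
  (1 / 4 : ℝ) * deriv (fun r : ℝ => deriv (fun s : ℝ => deriv (fun t : ℝ =>
    F ⟨w.proj, w.2 + r • u + s • v + t • z⟩ ^ 2) 0) 0) 0

/-- `F` is a Finsler metric on `M`. -/
structure IsFinslerMetric (F : TangentBundle 𝓘(ℝ, E) M → ℝ) : Prop where
  nonneg : ∀ w, 0 ≤ F w
  smooth : ContMDiffOn 𝓘(ℝ, E).tangent 𝓘(ℝ, ℝ) ∞ F (slit E M)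
  eq_zero_iff : ∀ w, F w = 0 ↔ w.2 = 0
  homogeneous : ∀ (w : TangentBundle 𝓘(ℝ, E) M) (c : ℝ), 0 < c →
    F ⟨w.proj, c • w.2⟩ = c * F w
  posDef : ∀ w ∈ slit E M, ∀ u : TangentSpace 𝓘(ℝ, E) w.proj, u ≠ 0 → 0 < fundTensor F w u u

/-- The pull-back `θ(X) = g_w(w, dπ(X))` to `TM \ 0` of the canonical 1-form of `T*M` by the
Legendre transformation `w ↦ g_w(w, ·)`. -/
def hilbertForm (F : TangentBundle 𝓘(ℝ, E) M → ℝ) (w : TangentBundle 𝓘(ℝ, E) M)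
    (ξ : TangentSpace 𝓘(ℝ, E).tangent w) : ℝ :=
  fundTensor F w w.2 (dproj w ξ)

/-- The symplectic form `ω_F = -dθ`, that is,
`ω_F(X, Y) = -(X θ(Y) - Y θ(X) - θ([X, Y]))` on vector fields. -/
def symplecticForm (F : TangentBundle 𝓘(ℝ, E) M → ℝ) (X Y : FieldTM E M)
    (w : TangentBundle 𝓘(ℝ, E) M) : ℝ :=
  -(dirDeriv 𝓘(ℝ, E).tangent (fun z => hilbertForm F z (Y z)) w (X w)
    - dirDeriv 𝓘(ℝ, E).tangent (fun z => hilbertForm F z (X z)) w (Y w)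
    - hilbertForm F w (VectorField.mlieBracket 𝓘(ℝ, E).tangent X Y w))

/-- `S` is the geodesic spray of `F`: the second order differential equation on `M` (a smooth
vector field on `TM \ 0` with `J(S) = C`) such that `d(F²/2) = ω_F(S, ·)`. -/
structure IsGeodesicSpray (F : TangentBundle 𝓘(ℝ, E) M → ℝ) (S : FieldTM E M) : Prop where
  smooth : SmoothFieldOn 𝓘(ℝ, E).tangent S (slit E M)
  second_order : ∀ w ∈ slit E M, almostTangent S w = vlift w w.2
  hamilton : ∀ (U : Set (TangentBundle 𝓘(ℝ, E) M)) (X : FieldTM E M), IsOpen U →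
    U ⊆ slit E M → SmoothFieldOn 𝓘(ℝ, E).tangent X U →
    ∀ w ∈ U, dirDeriv 𝓘(ℝ, E).tangent (fun z => F z ^ 2 / 2) w (X w) = symplecticForm F S X w

/-- `(D_U g_W)(T, V) = U(g_W(T, V)) - g_W(D_U T, V) - g_W(T, D_U V)` at `x`. -/
def covDerivFund (F : TangentBundle 𝓘(ℝ, E) M → ℝ) (D : AffineOperator E M)
    (W U T V : Π x : M, TangentSpace 𝓘(ℝ, E) x) (x : M) : ℝ :=
  dirDeriv 𝓘(ℝ, E) (fun y => fundTensor F ⟨y, W y⟩ (T y) (V y)) x (U x)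
    - fundTensor F ⟨x, W x⟩ (D T x (U x)) (V x)
    - fundTensor F ⟨x, W x⟩ (T x) (D V x (U x))

/-- `(D_A C_W)(U, V, Z)` at `x`, for the Cartan tensor `C`. -/
def covDerivCartan (F : TangentBundle 𝓘(ℝ, E) M → ℝ) (D : AffineOperator E M)
    (W A U V Z : Π x : M, TangentSpace 𝓘(ℝ, E) x) (x : M) : ℝ :=
  dirDeriv 𝓘(ℝ, E) (fun y => cartanTensor F ⟨y, W y⟩ (U y) (V y) (Z y)) x (A x)
    - cartanTensor F ⟨x, W x⟩ (D U x (A x)) (V x) (Z x)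
    - cartanTensor F ⟨x, W x⟩ (U x) (D V x (A x)) (Z x)
    - cartanTensor F ⟨x, W x⟩ (U x) (V x) (D Z x (A x))

/-- The integral curve of the vector field `W` through `x` is a geodesic of `S`: with that curve
denoted by `γ`, the curve `t ↦ γ'(t) = W(γ(t))` of `TM` is an integral curve of `S`. -/
def IsGeodesicFieldAt (S : FieldTM E M) (W : Π x : M, TangentSpace 𝓘(ℝ, E) x) (x : M) : Prop :=
  ∃ γ : ℝ → M, γ 0 = x ∧ IsMIntegralCurveAt (I := 𝓘(ℝ, E)) γ W 0 ∧
    IsMIntegralCurveAt (I := 𝓘(ℝ, E).tangent)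
      (fun t => (⟨γ t, W (γ t)⟩ : TangentBundle 𝓘(ℝ, E) M)) S 0

/-- `r` is a value of `(D^W_W C_W)(U, V, Z)` at `π(w)`, computed with some lift of `Γ_S` satisfying
`T1`, some nowhere null field `W` around `π(w)` extending `w` whose integral curve through `π(w)` is
a geodesic, and some extensions `U, V, Z` of `u, v, z`. -/
def IsLandsbergValue (F : TangentBundle 𝓘(ℝ, E) M → ℝ) (S : FieldTM E M)
    (w : TangentBundle 𝓘(ℝ, E) M) (u v z : TangentSpace 𝓘(ℝ, E) w.proj) (r : ℝ) : Prop :=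
  ∃ (nabla : VertOperator E M) (O : Set M) (W U V Z : Π x : M, TangentSpace 𝓘(ℝ, E) x),
    IsLift S nabla ∧ T1 S nabla ∧ IsOpen O ∧ w.proj ∈ O ∧
    SmoothFieldOn 𝓘(ℝ, E) W O ∧ SmoothFieldOn 𝓘(ℝ, E) U O ∧
    SmoothFieldOn 𝓘(ℝ, E) V O ∧ SmoothFieldOn 𝓘(ℝ, E) Z O ∧
    (∀ x ∈ O, W x ≠ 0) ∧ IsGeodesicFieldAt S W w.proj ∧
    W w.proj = w.2 ∧ U w.proj = u ∧ V w.proj = v ∧ Z w.proj = z ∧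
    r = covDerivCartan F (affineFamily S nabla W) W W U V Z w.proj

open Classical in
/-- The tensor `C'_w(u, v, z) = (D^W_W C_W)(u, v, z)` on `TM \ 0`. The value exists and is the same
for all choices of the lift and of the extensions; the second branch is never used for `w ≠ 0`. -/
def landsbergTensor (F : TangentBundle 𝓘(ℝ, E) M → ℝ) (S : FieldTM E M)
    (w : TangentBundle 𝓘(ℝ, E) M) (u v z : TangentSpace 𝓘(ℝ, E) w.proj) : ℝ :=
  if h : ∃ r, IsLandsbergValue F S w u v z r then h.choose else 0

/-! ### The four classical connections -/

/-- `(∇_X g)(Y, Z) = X(g(Y, Z)) - g(∇_X Y, Z) - g(Y, ∇_X Z)` at `w`. -/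
def nablaFund (F : TangentBundle 𝓘(ℝ, E) M → ℝ) (nabla : VertOperator E M) (X : FieldTM E M)
    (Y Z : VertSection E M) (w : TangentBundle 𝓘(ℝ, E) M) : ℝ :=
  dirDeriv 𝓘(ℝ, E).tangent (fun z => fundTensor F z (Y z) (Z z)) w (X w)
    - fundTensor F w (nabla Y w (X w)) (Z w) - fundTensor F w (Y w) (nabla Z w (X w))

/-- `(∇_X g)(Y, Z) = A(X, Y, Z)` for all `X, Y, Z`. -/
def NablaFundEq (F : TangentBundle 𝓘(ℝ, E) M → ℝ) (nabla : VertOperator E M)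
    (A : FieldTM E M → VertSection E M → VertSection E M → TangentBundle 𝓘(ℝ, E) M → ℝ) : Prop :=
  ∀ (U : Set (TangentBundle 𝓘(ℝ, E) M)) (X : FieldTM E M) (Y Z : VertSection E M), IsOpen U →
    U ⊆ slit E M → SmoothFieldOn 𝓘(ℝ, E).tangent X U → Y.SmoothOn U → Z.SmoothOn U →
    ∀ w ∈ U, nablaFund F nabla X Y Z w = A X Y Z w

/-- `(∇_X g)(·, ·) = 2 C(VX, ·, ·)`. -/
def M3 (F : TangentBundle 𝓘(ℝ, E) M → ℝ) (S : FieldTM E M) (nabla : VertOperator E M) : Prop :=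
  NablaFundEq F nabla fun X Y Z w =>
    2 * cartanTensor F w (vliftInv w (verPart S X w)) (Y w) (Z w)

/-- `(∇_X g)(·, ·) = -2 C'(JX, ·, ·)`. -/
def M4 (F : TangentBundle 𝓘(ℝ, E) M → ℝ) (S : FieldTM E M) (nabla : VertOperator E M) : Prop :=
  NablaFundEq F nabla fun X Y Z w =>
    -2 * landsbergTensor F S w (dproj w (X w)) (Y w) (Z w)

/-- `(∇_X g)(·, ·) = 2 C(VX, ·, ·) - 2 C'(JX, ·, ·)`. -/
def M5 (F : TangentBundle 𝓘(ℝ, E) M → ℝ) (S : FieldTM E M) (nabla : VertOperator E M) : Prop :=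
  NablaFundEq F nabla fun X Y Z w =>
    2 * cartanTensor F w (vliftInv w (verPart S X w)) (Y w) (Z w)
      - 2 * landsbergTensor F S w (dproj w (X w)) (Y w) (Z w)

/-- `∇ g = 0`. -/
def M6 (F : TangentBundle 𝓘(ℝ, E) M → ℝ) (nabla : VertOperator E M) : Prop :=
  NablaFundEq F nabla fun _ _ _ _ => 0

/-- `g(T(JX, Y), JZ) = g(T(JX, Z), JY)` for all `X, Y, Z`. -/
def M7 (F : TangentBundle 𝓘(ℝ, E) M → ℝ) (nabla : VertOperator E M) : Prop :=
  ∀ (U : Set (TangentBundle 𝓘(ℝ, E) M)) (X Y Z : FieldTM E M), IsOpen U → U ⊆ slit E M →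
    SmoothFieldOn 𝓘(ℝ, E).tangent X U → SmoothFieldOn 𝓘(ℝ, E).tangent Y U →
    SmoothFieldOn 𝓘(ℝ, E).tangent Z U →
    ∀ w ∈ U, fundTensor F w (torsion nabla (almostTangent X) Y w) (dproj w (Z w))
      = fundTensor F w (torsion nabla (almostTangent X) Z w) (dproj w (Y w))

/-- The Berwald connection of `F`. -/
def IsBerwald (F : TangentBundle 𝓘(ℝ, E) M → ℝ) (S : FieldTM E M)
    (nabla : VertOperator E M) : Prop :=
  IsLift S nabla ∧ T3 nabla ∧ M5 F S nabla

/-- The Cartan connection of `F`. -/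
def IsCartan (F : TangentBundle 𝓘(ℝ, E) M → ℝ) (S : FieldTM E M)
    (nabla : VertOperator E M) : Prop :=
  IsLift S nabla ∧ T2 S nabla ∧ M6 F nabla ∧ M7 F nabla

/-- The Chern–Rund connection of `F`. -/
def IsChernRund (F : TangentBundle 𝓘(ℝ, E) M → ℝ) (S : FieldTM E M)
    (nabla : VertOperator E M) : Prop :=
  IsLift S nabla ∧ T3 nabla ∧ M3 F S nabla

/-- The Hashiguchi connection of `F`. -/
def IsHashiguchi (F : TangentBundle 𝓘(ℝ, E) M → ℝ) (S : FieldTM E M)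
    (nabla : VertOperator E M) : Prop :=
  IsLift S nabla ∧ T2 S nabla ∧ M4 F S nabla ∧ M7 F nabla

/-! ### The two sets of properties of a family of affine connections -/

/-- `D` is an affine connection on `O` with `D_U V - D_V U = [U, V]` and
`(D_U g_W)(T, V) = 2 C_W(D_U W, T, V)`. -/
structure IsCartanChernRundType (F : TangentBundle 𝓘(ℝ, E) M → ℝ)
    (O : Set M) (W : Π x : M, TangentSpace 𝓘(ℝ, E) x) (D : AffineOperator E M) : Prop where
  affine : IsAffineConnectionOn O D
  torsionFree : IsTorsionFreeOn O D
  metric : ∀ U T V : Π x : M, TangentSpace 𝓘(ℝ, E) x, SmoothFieldOn 𝓘(ℝ, E) U O →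
    SmoothFieldOn 𝓘(ℝ, E) T O → SmoothFieldOn 𝓘(ℝ, E) V O → ∀ x ∈ O,
    covDerivFund F D W U T V x = 2 * cartanTensor F ⟨x, W x⟩ (D W x (U x)) (T x) (V x)

/-- `D` is an affine connection on `O` with `D_U V - D_V U = [U, V]` and
`(D_U g_W)(T, V) = 2 C_W(D_U W, T, V) - 2 C'_W(U, T, V)`. -/
structure IsBerwaldHashiguchiType (F : TangentBundle 𝓘(ℝ, E) M → ℝ) (S : FieldTM E M)
    (O : Set M) (W : Π x : M, TangentSpace 𝓘(ℝ, E) x) (D : AffineOperator E M) : Prop where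
  affine : IsAffineConnectionOn O D
  torsionFree : IsTorsionFreeOn O D
  metric : ∀ U T V : Π x : M, TangentSpace 𝓘(ℝ, E) x, SmoothFieldOn 𝓘(ℝ, E) U O →
    SmoothFieldOn 𝓘(ℝ, E) T O → SmoothFieldOn 𝓘(ℝ, E) V O → ∀ x ∈ O,
    covDerivFund F D W U T V x = 2 * cartanTensor F ⟨x, W x⟩ (D W x (U x)) (T x) (V x)
      - 2 * landsbergTensor F S ⟨x, W x⟩ (U x) (T x) (V x)

/-- `D` and `D'` agree as operators on smooth vector fields on `O`. -/
def AgreeOn (O : Set M) (D D' : AffineOperator E M) : Prop :=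
  ∀ U V : Π x : M, TangentSpace 𝓘(ℝ, E) x, SmoothFieldOn 𝓘(ℝ, E) U O →
    SmoothFieldOn 𝓘(ℝ, E) V O → ∀ x ∈ O, D V x (U x) = D' V x (U x)

end Finsler

end

set_option linter.unusedSectionVars false

noncomputable section

/-! The proof compares two lifts of a vector $u$ at the point $w = W(x)$ of $TM$: the horizontal
lift $u^{\mathfrak h}$, which defines $D^W$, and $W_*u$, along which $g_W$ is differentiated. Both
project to $u$, so $W_*u = u^{\mathfrak h} + i_w(v)$ for some $v$, and the crux is that $v =
D^W_uW$. The lift condition gives $\nabla_{W_*u}C = v$; the sections $C$ and $W^{\mathfrak v}$ agree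
on the image of $W$, so also $\nabla_{W_*u}W^{\mathfrak v} = v$; hence $v = D^W_uW + \nabla_{i_w
v}W^{\mathfrak v}$, and the last term has to vanish (`IsSemispray.sectionDeriv_eq`).

For Chern–Rund and Berwald it vanishes because $T(\mathscr JX, V^{\mathfrak h}) = \nabla_{\mathscr
JX}V^{\mathfrak v}$ (`IsSemispray.nabla_vlift_of_T3`). For Cartan and Hashiguchi, $g$ is parallel in
vertical directions and $\mathrm C_w(\cdot, w, \cdot) = 0$ by homogeneity, so
$g(\nabla_{i_wv}W^{\mathfrak v}, Z) + g(W, \nabla_{i_wv}Z^{\mathfrak v}) = 0$; the symmetry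
condition on the torsion makes the two terms equal, so both are zero
(`IsSemispray.nabla_vlift_of_M7`).

Since $2\mathrm C$ is the vertical derivative of $g$, splitting $W_*U$ yields $(D^W_Ug_W)(T,V) =
(\nabla_{U^{\mathfrak h}}g)(T^{\mathfrak v},V^{\mathfrak v}) + 2\mathrm C_W(D^W_UW,T,V)$
(`IsSemispray.covDerivFund_eq`). On horizontal vectors each axiom for $\nabla g$ reduces to $0$ or
to $-2\mathrm C'$. The torsion identity holds because $[U^{\mathfrak h},V^{\mathfrak h}]$ projects
to $[U,V]$.

Uniqueness is a Koszul argument for the symmetric difference $\Delta$ of two connections. The Cartan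
term contains $\Delta(\cdot,W)$, but it dies whenever $W$ is one of the last two arguments, so
$\Delta(W,W)$, then $\Delta(U,W)$, then $\Delta(U,T)$ vanish in turn
(`IsFinslerMetric.agreeOn_of_metric`). -/

namespace Finsler

/-! ### Tangent vectors, smoothness and Lie brackets in a chart -/

section Charts

variable {V : Type*} [NormedAddCommGroup V] [NormedSpace ℝ V]
  {H : Type*} [TopologicalSpace H] (I : ModelWithCorners ℝ V H)
  {N : Type*} [TopologicalSpace N] [ChartedSpace H N] [IsManifold I ∞ N]

/-- The derivative at `z` of the chart centred at `x₀`. -/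
def chartDeriv (x₀ z : N) : TangentSpace I z →L[ℝ] V :=
  (trivializationAt V (TangentSpace I : N → Type _) x₀).continuousLinearMapAt ℝ z

/-- The inverse of the derivative at `z` of the chart centred at `x₀`. -/
def chartDerivSymm (x₀ z : N) : V →L[ℝ] TangentSpace I z :=
  (trivializationAt V (TangentSpace I : N → Type _) x₀).symmL ℝ z

variable {I} {x₀ z : N}

lemma chartDeriv_chartDerivSymm (hz : z ∈ (chartAt H x₀).source) (v : V) :
    chartDeriv I x₀ z (chartDerivSymm I x₀ z v) = v :=
  Trivialization.continuousLinearMapAt_symmL _ (by simpa using hz) v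

lemma chartDerivSymm_chartDeriv (hz : z ∈ (chartAt H x₀).source) (ξ : TangentSpace I z) :
    chartDerivSymm I x₀ z (chartDeriv I x₀ z ξ) = ξ :=
  Trivialization.symmL_continuousLinearMapAt _ (by simpa using hz) ξ

lemma chartDeriv_injective (hz : z ∈ (chartAt H x₀).source) :
    Function.Injective (chartDeriv I x₀ z) :=
  Function.LeftInverse.injective (chartDerivSymm_chartDeriv hz)

lemma chartDeriv_eq (hz : z ∈ (chartAt H x₀).source) (ξ : TangentSpace I z) :
    chartDeriv I x₀ z ξ = mvfderiv I (extChartAt I x₀) z ξ :=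
  DFunLike.congr_fun (TangentBundle.continuousLinearMapAt_trivializationAt hz) ξ

lemma trivializationAt_snd (hz : z ∈ (chartAt H x₀).source) (ξ : TangentSpace I z) :
    (trivializationAt V (TangentSpace I : N → Type _) x₀ ⟨z, ξ⟩).2 = chartDeriv I x₀ z ξ := by
  rw [chartDeriv, Trivialization.continuousLinearMapAt_apply,
    Trivialization.coe_linearMapAt_of_mem]
  simpa using hz

variable {P : Type*} [TopologicalSpace P] {V' : Type*} [NormedAddCommGroup V'] [NormedSpace ℝ V']
  {H' : Type*} [TopologicalSpace H'] {J : ModelWithCorners ℝ V' H'} [ChartedSpace H' P]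

/-- The centre $x_0$ need not be the foot point of `f p`, so a single chart serves for all nearby
points. -/
lemma contMDiffAt_tangent_iff {f : P → TangentBundle I N} {p : P}
    (hz : (f p).proj ∈ (chartAt H x₀).source) :
    ContMDiffAt J I.tangent ∞ f p ↔ ContMDiffAt J I ∞ (fun q => (f q).proj) p ∧
      ContMDiffAt J 𝓘(ℝ, V) ∞ (fun q => chartDeriv I x₀ (f q).proj (f q).2) p := by
  rw [Trivialization.contMDiffAt_iff
    (e := trivializationAt V (TangentSpace I : N → Type _) x₀)
    (by simpa [Trivialization.mem_source] using hz)]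
  refine and_congr_right fun h => ?_
  refine Filter.EventuallyEq.contMDiffAt_iff ?_
  filter_upwards [h.continuousAt.preimage_mem_nhds ((chartAt H x₀).open_source.mem_nhds hz)]
    with q hq
  exact trivializationAt_snd hq _

lemma mdifferentiableAt_tangent_iff {f : P → TangentBundle I N} {p : P}
    (hz : (f p).proj ∈ (chartAt H x₀).source) :
    MDifferentiableAt J I.tangent f p ↔ MDifferentiableAt J I (fun q => (f q).proj) p ∧
      MDifferentiableAt J 𝓘(ℝ, V) (fun q => chartDeriv I x₀ (f q).proj (f q).2) p := by
  rw [Trivialization.mdifferentiableAt_totalSpace_iff I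
    (e := trivializationAt V (TangentSpace I : N → Type _) x₀) f
    (by simpa [Trivialization.mem_source] using hz)]
  refine and_congr_right fun h => ?_
  refine Filter.EventuallyEq.mdifferentiableAt_iff ?_
  filter_upwards [h.continuousAt.preimage_mem_nhds ((chartAt H x₀).open_source.mem_nhds hz)]
    with q hq
  exact trivializationAt_snd hq _

/-- The coordinate expression of the vector field `X` in the chart centred at `x₀`. -/
def coordField (I : ModelWithCorners ℝ V H) (x₀ : N) [IsManifold I ∞ N]
    (X : Π x : N, TangentSpace I x) : V → V :=
  fun q => chartDeriv I x₀ ((extChartAt I x₀).symm q) (X ((extChartAt I x₀).symm q))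

variable [I.Boundaryless]

lemma differentiableAt_comp_chart_symm {f : N → V'} (hz : z ∈ (chartAt H x₀).source)
    (hf : MDifferentiableAt I 𝓘(ℝ, V') f z) :
    DifferentiableAt ℝ (fun q => f ((extChartAt I x₀).symm q)) (extChartAt I x₀ z) := by
  have h1 : (extChartAt I x₀).symm (extChartAt I x₀ z) = z :=
    (extChartAt I x₀).left_inv (by simpa using hz)
  have hz' : extChartAt I x₀ z ∈ (extChartAt I x₀).target :=
    (extChartAt I x₀).map_source (by simpa using hz)
  have h2 := mdifferentiableWithinAt_extChartAt_symm (I := I) hz'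
  rw [I.range_eq_univ, mdifferentiableWithinAt_univ] at h2
  rw [← h1] at hf
  exact (hf.comp _ h2).differentiableAt

lemma differentiableAt_coordField {X : Π x : N, TangentSpace I x}
    (hX : MDifferentiableAt I I.tangent (fun x => (⟨x, X x⟩ : TangentBundle I N)) x₀) :
    DifferentiableAt ℝ (coordField I x₀ X) (extChartAt I x₀ x₀) :=
  differentiableAt_comp_chart_symm (mem_chart_source H x₀)
    ((mdifferentiableAt_tangent_iff (x₀ := x₀) (mem_chart_source H x₀)).1 hX).2

lemma eventually_chart_symm_mem (x₀ : N) : ∀ᶠ q in 𝓝 (extChartAt I x₀ x₀),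
    q ∈ (extChartAt I x₀).target ∧ (extChartAt I x₀).symm q ∈ (chartAt H x₀).source := by
  filter_upwards [extChartAt_target_mem_nhds (I := I) x₀] with q hq
  exact ⟨hq, by simpa using (extChartAt I x₀).map_target hq⟩

/-- The manifold bracket is computed from pullbacks along the inverse chart, whose derivative is
inverse to `chartDeriv`; this identifies those pullbacks with coordinate fields. -/
lemma mpullback_chart_symm {q : V} (hq : q ∈ (extChartAt I x₀).target)
    (X : Π x : N, TangentSpace I x) :
    VectorField.mpullbackWithin 𝓘(ℝ, V) I (extChartAt I x₀).symm X (range I) q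
      = coordField I x₀ X q := by
  have hz : (extChartAt I x₀).symm q ∈ (chartAt H x₀).source := by
    simpa using (extChartAt I x₀).map_target hq
  rw [VectorField.mpullbackWithin_apply]
  set L := mfderivWithin 𝓘(ℝ, V) I (extChartAt I x₀).symm (range I) q with hL
  have hinv : L.IsInvertible := isInvertible_mfderivWithin_extChartAt_symm hq
  have h1 : ∀ v : V, chartDeriv I x₀ ((extChartAt I x₀).symm q) (L v) = v := fun v => by
    rw [chartDeriv_eq hz]
    exact DFunLike.congr_fun (mfderiv_extChartAt_comp_mfderivWithin_extChartAt_symm hq) v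
  have h2 := h1 (L.inverse (X ((extChartAt I x₀).symm q)))
  rw [hinv.self_apply_inverse] at h2
  exact h2.symm

/-- Every later bracket computation passes through this formula, which replaces the bracket by
Fréchet derivatives in a vector space. -/
lemma chartDeriv_mlieBracket (X Y : Π x : N, TangentSpace I x) :
    chartDeriv I x₀ x₀ (VectorField.mlieBracket I X Y x₀)
      = VectorField.lieBracket ℝ (coordField I x₀ X) (coordField I x₀ Y) (extChartAt I x₀ x₀) := by
  have hx := mem_chart_source H x₀
  rw [VectorField.mlieBracket, VectorField.mlieBracketWithin_apply, chartDeriv_eq hx]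
  have hinv : (mfderiv I 𝓘(ℝ, V) (extChartAt I x₀) x₀).IsInvertible :=
    isInvertible_mfderiv_extChartAt (by simp)
  refine (hinv.self_apply_inverse _).trans ?_
  rw [preimage_univ, univ_inter, I.range_eq_univ]
  have h0 : ∀ (A B : V → V) (q : V), VectorField.lieBracketWithin ℝ A B univ q
      = VectorField.lieBracket ℝ A B q := fun A B q => by
    rw [VectorField.lieBracketWithin_univ]
  refine (h0 _ _ _).trans ?_
  have h : ∀ X : Π x : N, TangentSpace I x,
      VectorField.mpullbackWithin 𝓘(ℝ, V) I (extChartAt I x₀).symm X univ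
        =ᶠ[𝓝 (extChartAt I x₀ x₀)] coordField I x₀ X := fun X => by
    filter_upwards [eventually_chart_symm_mem (I := I) x₀] with q hq
    rw [← mpullback_chart_symm hq.1, I.range_eq_univ]
  exact (h X).lieBracket_vectorField_eq (h Y)

end Charts

/-! ### Natural charts of the tangent bundle, projection and vertical lift -/

section TangentBundleCharts

variable {E : Type*} [NormedAddCommGroup E] [NormedSpace ℝ E]
  {M : Type*} [TopologicalSpace M] [ChartedSpace E M] [IsManifold 𝓘(ℝ, E) ∞ M]
  {w₀ z : TangentBundle 𝓘(ℝ, E) M}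

lemma mem_chart_tangent_source :
    z ∈ (chartAt (ModelProd E E) w₀).source ↔ z.proj ∈ (chartAt E w₀.proj).source :=
  TangentBundle.mem_chart_source_iff z w₀

lemma extChartAt_tangent_snd (hz : z.proj ∈ (chartAt E w₀.proj).source) :
    (extChartAt 𝓘(ℝ, E).tangent w₀ z).2 = chartDeriv 𝓘(ℝ, E) w₀.proj z.proj z.2 :=
  trivializationAt_snd (I := 𝓘(ℝ, E)) hz z.2

lemma mdifferentiableAt_proj :
    MDifferentiableAt 𝓘(ℝ, E).tangent 𝓘(ℝ, E)
      (fun z : TangentBundle 𝓘(ℝ, E) M => z.proj) z :=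
  ((contMDiff_proj (n := 1) (TangentSpace 𝓘(ℝ, E) : M → Type _)) z).mdifferentiableAt one_ne_zero

/-- The first component of the natural chart of $TM$ is the chart of $M$ composed with $\pi$; the
chain rule does the rest. -/
lemma chartDeriv_fst (hz : z.proj ∈ (chartAt E w₀.proj).source)
    (ξ : TangentSpace 𝓘(ℝ, E).tangent z) :
    (chartDeriv 𝓘(ℝ, E).tangent w₀ z ξ).1
      = chartDeriv 𝓘(ℝ, E) w₀.proj z.proj (dproj z ξ) := by
  have hz' := mem_chart_tangent_source.2 hz
  rw [chartDeriv_eq hz', chartDeriv_eq hz]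
  have h1 := (mdifferentiableAt_extChartAt (I := 𝓘(ℝ, E).tangent) hz').hasMFDerivAt
  have h2 := (mdifferentiableAt_extChartAt (I := 𝓘(ℝ, E)) hz).hasMFDerivAt
  have h3 := h2.comp z mdifferentiableAt_proj.hasMFDerivAt
  have h4 : HasMFDerivAt 𝓘(ℝ, E × E) 𝓘(ℝ, E) (Prod.fst : E × E → E)
    (extChartAt 𝓘(ℝ, E).tangent w₀ z) (ContinuousLinearMap.fst ℝ E E) :=
    (ContinuousLinearMap.fst ℝ E E).hasFDerivAt.hasMFDerivAt
  have h5 := h4.comp z h1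
  exact DFunLike.congr_fun (hasMFDerivAt_unique h5 h3) ξ

lemma mdifferentiableAt_fiberLine (u : TangentSpace 𝓘(ℝ, E) z.proj) (t : ℝ) :
    MDifferentiableAt 𝓘(ℝ, ℝ) 𝓘(ℝ, E).tangent
      (fun t : ℝ => (⟨z.proj, z.2 + t • u⟩ : TangentBundle 𝓘(ℝ, E) M)) t := by
  rw [mdifferentiableAt_tangent_iff (x₀ := z.proj) (mem_chart_source E z.proj)]
  refine ⟨mdifferentiableAt_const, ?_⟩
  simp only [map_add, map_smul]
  exact DifferentiableAt.mdifferentiableAt (by fun_prop)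

/-- In the natural chart the curve $t \mapsto z + tu$ is an affine line with constant first
component. -/
lemma chartDeriv_vlift (hz : z.proj ∈ (chartAt E w₀.proj).source)
    (u : TangentSpace 𝓘(ℝ, E) z.proj) :
    chartDeriv 𝓘(ℝ, E).tangent w₀ z (vlift z u)
      = (0, chartDeriv 𝓘(ℝ, E) w₀.proj z.proj u) := by
  set c : ℝ → TangentBundle 𝓘(ℝ, E) M := fun t => ⟨z.proj, z.2 + t • u⟩ with hc
  have hc0 : c 0 = z := by simp [hc]
  have hz' := mem_chart_tangent_source.2 hz
  rw [chartDeriv_eq hz']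
  have h1 : HasMFDerivAt 𝓘(ℝ, E).tangent 𝓘(ℝ, E × E) (extChartAt 𝓘(ℝ, E).tangent w₀) (c 0)
      (mfderiv 𝓘(ℝ, E).tangent 𝓘(ℝ, E × E) (extChartAt 𝓘(ℝ, E).tangent w₀) (c 0)) :=
    (mdifferentiableAt_extChartAt (I := 𝓘(ℝ, E).tangent) (by rw [hc0]; exact hz')).hasMFDerivAt
  have h2 := h1.comp (0 : ℝ) (mdifferentiableAt_fiberLine u 0).hasMFDerivAt
  have h3 : HasFDerivAt (fun t : ℝ => ((extChartAt 𝓘(ℝ, E) w₀.proj z.proj,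
      chartDeriv 𝓘(ℝ, E) w₀.proj z.proj z.2 + t • chartDeriv 𝓘(ℝ, E) w₀.proj z.proj u) : E × E))
      ((ContinuousLinearMap.toSpanSingleton ℝ
        ((0, chartDeriv 𝓘(ℝ, E) w₀.proj z.proj u) : E × E))) 0 := by
    rw [hasFDerivAt_iff_hasDerivAt]
    simp only [ContinuousLinearMap.toSpanSingleton_apply, one_smul]
    refine HasDerivAt.prodMk (hasDerivAt_const _ _) ?_
    simpa using ((hasDerivAt_id (0 : ℝ)).smul_const
      (chartDeriv 𝓘(ℝ, E) w₀.proj z.proj u)).const_add (chartDeriv 𝓘(ℝ, E) w₀.proj z.proj z.2)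
  have h4 : (extChartAt 𝓘(ℝ, E).tangent w₀ ∘ c) = fun t : ℝ =>
      ((extChartAt 𝓘(ℝ, E) w₀.proj z.proj,
      chartDeriv 𝓘(ℝ, E) w₀.proj z.proj z.2 + t • chartDeriv 𝓘(ℝ, E) w₀.proj z.proj u) : E × E) := by
    funext t
    refine Prod.ext rfl ?_
    refine (extChartAt_tangent_snd (z := c t) hz).trans ?_
    exact (map_add _ _ _).trans (by rw [map_smul])
  rw [h4] at h2
  have h5 := DFunLike.congr_fun (hasMFDerivAt_unique h2 h3.hasMFDerivAt) (1 : ℝ)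
  have h6 : (ContinuousLinearMap.toSpanSingleton ℝ
        ((0, chartDeriv 𝓘(ℝ, E) w₀.proj z.proj u) : E × E)) 1
        = (0, chartDeriv 𝓘(ℝ, E) w₀.proj z.proj u) := by simp
  rw [← h6]
  refine Eq.trans ?_ h5
  -- `c 0` equals `z` only propositionally, as $z + 0\cdot u$, so the derivative is transported
  -- between two tangent spaces that are both the model space $E \times E$.
  have key : ∀ (y : TangentBundle 𝓘(ℝ, E) M) (hy : y = z) (η : E × E),
      mfderiv 𝓘(ℝ, E).tangent 𝓘(ℝ, E × E) (extChartAt 𝓘(ℝ, E).tangent w₀) z η =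
      mfderiv 𝓘(ℝ, E).tangent 𝓘(ℝ, E × E) (extChartAt 𝓘(ℝ, E).tangent w₀) y η := by
    rintro y rfl η
    rfl
  exact key (c 0) hc0 _

lemma vlift_injective (w : TangentBundle 𝓘(ℝ, E) M) : Function.Injective (vlift w) := by
  intro u v h
  have h1 := chartDeriv_vlift (w₀ := w) (mem_chart_source E w.proj) u
  rw [h, chartDeriv_vlift (mem_chart_source E w.proj)] at h1
  exact (chartDeriv_injective (mem_chart_source E w.proj) (Prod.ext_iff.1 h1).2).symm

lemma dproj_vlift (w : TangentBundle 𝓘(ℝ, E) M) (u : TangentSpace 𝓘(ℝ, E) w.proj) :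
    dproj w (vlift w u) = 0 := by
  apply chartDeriv_injective (I := 𝓘(ℝ, E)) (mem_chart_source E w.proj)
  rw [← chartDeriv_fst (mem_chart_source E w.proj), chartDeriv_vlift (mem_chart_source E w.proj)]
  simp

end TangentBundleCharts

/-! ### Pointwise smoothness and local extension of vectors -/

section SmoothFieldAt

variable {V : Type*} [NormedAddCommGroup V] [NormedSpace ℝ V]
  {H : Type*} [TopologicalSpace H] (I : ModelWithCorners ℝ V H)
  {N : Type*} [TopologicalSpace N] [ChartedSpace H N] [IsManifold I ∞ N]

/-- The vector field `X` is smooth at `x`. -/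
def SmoothFieldAt (X : Π x : N, TangentSpace I x) (x : N) : Prop :=
  ContMDiffAt I I.tangent ∞ (fun x => (⟨x, X x⟩ : TangentBundle I N)) x

variable {I} {X : Π x : N, TangentSpace I x} {x x₀ : N}

lemma SmoothFieldOn.smoothFieldAt {U : Set N} (h : SmoothFieldOn I X U) (hU : IsOpen U)
    (hx : x ∈ U) : SmoothFieldAt I X x :=
  ContMDiffOn.contMDiffAt h (hU.mem_nhds hx)

lemma smoothFieldOn_of_forall {U : Set N} (h : ∀ x ∈ U, SmoothFieldAt I X x) :
    SmoothFieldOn I X U :=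
  fun x hx => (h x hx).contMDiffWithinAt

lemma SmoothFieldAt.mdifferentiableAt (h : SmoothFieldAt I X x) :
    MDifferentiableAt I I.tangent (fun x => (⟨x, X x⟩ : TangentBundle I N)) x :=
  ContMDiffAt.mdifferentiableAt h (by simp)

lemma smoothFieldAt_iff (hx : x ∈ (chartAt H x₀).source) :
    SmoothFieldAt I X x ↔ ContMDiffAt I 𝓘(ℝ, V) ∞ (fun z => chartDeriv I x₀ z (X z)) x :=
  (contMDiffAt_tangent_iff hx).trans (and_iff_right contMDiffAt_id)

lemma smoothFieldAt_chartDerivSymm (hx : x ∈ (chartAt H x₀).source) {c : N → V}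
    (hc : ContMDiffAt I 𝓘(ℝ, V) ∞ c x) :
    SmoothFieldAt I (fun z => chartDerivSymm I x₀ z (c z)) x := by
  rw [smoothFieldAt_iff hx]
  refine hc.congr_of_eventuallyEq ?_
  filter_upwards [(chartAt H x₀).open_source.mem_nhds hx] with z hz
  exact chartDeriv_chartDerivSymm hz _

/-- The extension has constant coordinates. It allows conditions quantified over local fields to be
applied to a single vector. -/
lemma exists_smoothFieldOn_extension (x : N) (ξ : TangentSpace I x) :
    ∃ X : Π x : N, TangentSpace I x, SmoothFieldOn I X (chartAt H x).source ∧ X x = ξ :=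
  ⟨fun z => chartDerivSymm I x z (chartDeriv I x x ξ),
    smoothFieldOn_of_forall fun _ hz => smoothFieldAt_chartDerivSymm hz contMDiffAt_const,
    chartDerivSymm_chartDeriv (mem_chart_source H x) ξ⟩

end SmoothFieldAt

/-! ### Semisprays and $\Gamma_S$ in natural coordinates -/

variable {E : Type*} [NormedAddCommGroup E] [NormedSpace ℝ E]
  {M : Type*} [TopologicalSpace M] [ChartedSpace E M] [IsManifold 𝓘(ℝ, E) ∞ M]
  {w z : TangentBundle 𝓘(ℝ, E) M} {S X : FieldTM E M}

lemma contMDiffAt_proj_tangent :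
    ContMDiffAt 𝓘(ℝ, E).tangent 𝓘(ℝ, E) ∞ (fun z : TangentBundle 𝓘(ℝ, E) M => z.proj) z :=
  contMDiff_proj (TangentSpace 𝓘(ℝ, E) : M → Type _) z

lemma isOpen_slit : IsOpen (slit E M) := by
  refine isOpen_iff_mem_nhds.2 fun w hw => ?_
  have hx := mem_chart_source E w.proj
  have h := ((contMDiffAt_tangent_iff (x₀ := w.proj) (J := 𝓘(ℝ, E).tangent) hx).1
    (contMDiffAt_id (x := w))).2.continuousAt
  have h0 : chartDeriv 𝓘(ℝ, E) w.proj w.proj w.2 ≠ 0 := fun h0 =>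
    hw (chartDeriv_injective hx (h0.trans (map_zero _).symm))
  filter_upwards [h.eventually_ne h0] with z hz hz2
  exact hz (by simp only [id]; rw [hz2, map_zero])

lemma isOpen_preimage_proj {O : Set M} (hO : IsOpen O) :
    IsOpen {z : TangentBundle 𝓘(ℝ, E) M | z.proj ∈ O} :=
  hO.preimage (FiberBundle.continuous_proj E (TangentSpace 𝓘(ℝ, E) : M → Type _))

/-- A second order differential equation on `M`. -/
structure IsSemispray (S : FieldTM E M) : Prop where
  smooth : SmoothFieldOn 𝓘(ℝ, E).tangent S (slit E M)
  second_order : ∀ w ∈ slit E M, almostTangent S w = vlift w w.2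

lemma IsGeodesicSpray.isSemispray {F : TangentBundle 𝓘(ℝ, E) M → ℝ}
    (h : IsGeodesicSpray F S) : IsSemispray S :=
  ⟨h.smooth, h.second_order⟩

lemma IsSemispray.smoothFieldAt (hS : IsSemispray S) (hw : w ∈ slit E M) :
    SmoothFieldAt 𝓘(ℝ, E).tangent S w :=
  hS.smooth.smoothFieldAt isOpen_slit hw

lemma IsSemispray.dproj_eq (hS : IsSemispray S) (hw : w ∈ slit E M) : dproj w (S w) = w.2 :=
  vlift_injective w (hS.second_order w hw)

lemma chartDeriv_almostTangent (hz : z.proj ∈ (chartAt E w.proj).source) :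
    chartDeriv 𝓘(ℝ, E).tangent w z (almostTangent X z)
      = (0, (chartDeriv 𝓘(ℝ, E).tangent w z (X z)).1) := by
  rw [almostTangent, chartDeriv_vlift hz, chartDeriv_fst hz]

lemma SmoothFieldAt.almostTangent (hX : SmoothFieldAt 𝓘(ℝ, E).tangent X w) :
    SmoothFieldAt 𝓘(ℝ, E).tangent (almostTangent X) w := by
  have hw := mem_chart_source (ModelProd E E) w
  rw [smoothFieldAt_iff hw] at hX ⊢
  have h : ContMDiffAt 𝓘(ℝ, E).tangent 𝓘(ℝ, E × E) ∞ (fun z =>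
      ((0, (chartDeriv 𝓘(ℝ, E).tangent w z (X z)).1) : E × E)) w :=
    ((ContinuousLinearMap.inr ℝ E E).comp
      (ContinuousLinearMap.fst ℝ E E)).contMDiff.contMDiffAt.comp w hX
  refine h.congr_of_eventuallyEq ?_
  filter_upwards [(chartAt (ModelProd E E) w).open_source.mem_nhds hw] with z hz
  exact chartDeriv_almostTangent (mem_chart_tangent_source.1 hz)

lemma coordField_almostTangent {q : E × E}
    (hq : (extChartAt 𝓘(ℝ, E).tangent w).symm q ∈ (chartAt (ModelProd E E) w).source) :
    coordField 𝓘(ℝ, E).tangent w (almostTangent X) q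
      = (0, (coordField 𝓘(ℝ, E).tangent w X q).1) :=
  chartDeriv_almostTangent (mem_chart_tangent_source.1 hq)

/-- In natural coordinates $(x, y)$ the condition $\mathscr J(S) = C$ says that $S = (y, G(x, y))$.
Knowing this near the point, and not only at it, gives the derivative of the first component. -/
lemma IsSemispray.eventually_coordField_fst (hS : IsSemispray S) (hw : w ∈ slit E M) :
    (fun q => (coordField 𝓘(ℝ, E).tangent w S q).1)
      =ᶠ[𝓝 (extChartAt 𝓘(ℝ, E).tangent w w)] Prod.snd := by
  have h1 := (continuousAt_extChartAt_symm (I := 𝓘(ℝ, E).tangent) w).preimage_mem_nhds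
    (by rw [extChartAt_to_inv]; exact isOpen_slit.mem_nhds hw)
  filter_upwards [eventually_chart_symm_mem (I := 𝓘(ℝ, E).tangent) w, h1] with q hq hq1
  have hz := mem_chart_tangent_source.1 hq.2
  refine (chartDeriv_fst hz _).trans ?_
  rw [hS.dproj_eq hq1, ← extChartAt_tangent_snd hz, (extChartAt 𝓘(ℝ, E).tangent w).right_inv hq.1]

/-- The linear part of the connection of the semispray `S` in the natural coordinates at `w`. -/
def sprayCoeff (S : FieldTM E M) (w : TangentBundle 𝓘(ℝ, E) M) : E →L[ℝ] E :=
  (ContinuousLinearMap.snd ℝ E E).comp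
    ((fderiv ℝ (coordField 𝓘(ℝ, E).tangent w S) (extChartAt 𝓘(ℝ, E).tangent w w)).comp
      (ContinuousLinearMap.inr ℝ E E))

lemma coordField_self {x₀ : TangentBundle 𝓘(ℝ, E) M} :
    coordField 𝓘(ℝ, E).tangent x₀ X (extChartAt 𝓘(ℝ, E).tangent x₀ x₀)
      = chartDeriv 𝓘(ℝ, E).tangent x₀ x₀ (X x₀) := by
  rw [coordField, extChartAt_to_inv]

/-- With $X = (a, b)$ and $S = (y, G)$, $\mathscr J[S,X] = (0, da(S) - b)$ and $[S, \mathscr JX] =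
(-a, da(S) - G_ya)$. The derivatives of $X$ cancel in the difference, so $\Gamma_S$ acts pointwise
and linearly. -/
lemma IsSemispray.chartDeriv_grifone (hS : IsSemispray S) (hw : w ∈ slit E M)
    (hX : SmoothFieldAt 𝓘(ℝ, E).tangent X w) :
    chartDeriv 𝓘(ℝ, E).tangent w w (grifone S X w)
      = ((chartDeriv 𝓘(ℝ, E).tangent w w (X w)).1,
        sprayCoeff S w (chartDeriv 𝓘(ℝ, E).tangent w w (X w)).1
          - (chartDeriv 𝓘(ℝ, E).tangent w w (X w)).2) := by
  have hw' := mem_chart_source E w.proj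
  set q₀ := extChartAt 𝓘(ℝ, E).tangent w w with hq₀
  set S' := coordField 𝓘(ℝ, E).tangent w S with hS'
  set X' := coordField 𝓘(ℝ, E).tangent w X with hX'
  have dS : DifferentiableAt ℝ S' q₀ :=
    differentiableAt_coordField (hS.smoothFieldAt hw).mdifferentiableAt
  have dX : DifferentiableAt ℝ X' q₀ := differentiableAt_coordField hX.mdifferentiableAt
  have hX0 : X' q₀ = chartDeriv 𝓘(ℝ, E).tangent w w (X w) := coordField_self
  have hJ : coordField 𝓘(ℝ, E).tangent w (Finsler.almostTangent X) =ᶠ[𝓝 q₀]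
      fun q => ((ContinuousLinearMap.inr ℝ E E).comp (ContinuousLinearMap.fst ℝ E E)) (X' q) := by
    filter_upwards [eventually_chart_symm_mem (I := 𝓘(ℝ, E).tangent) w] with q hq
    exact coordField_almostTangent hq.2
  have hS1 : ∀ v, (fderiv ℝ S' q₀ v).1 = v.2 := fun v => by
    have h1 := (hS.eventually_coordField_fst hw).fderiv_eq (𝕜 := ℝ)
    have h2 := ((ContinuousLinearMap.fst ℝ E E).hasFDerivAt.comp q₀ dS.hasFDerivAt).fderiv
    have h3 := (ContinuousLinearMap.snd ℝ E E).hasFDerivAt (x := q₀) |>.fderiv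
    exact DFunLike.congr_fun (h2.symm.trans (h1.trans h3)) v
  have dJ := (((ContinuousLinearMap.inr ℝ E E).comp
    (ContinuousLinearMap.fst ℝ E E)).hasFDerivAt.comp q₀ dX.hasFDerivAt).fderiv
  have b1 : chartDeriv 𝓘(ℝ, E).tangent w w (VectorField.mlieBracket 𝓘(ℝ, E).tangent S X w)
      = fderiv ℝ X' q₀ (S' q₀) - fderiv ℝ S' q₀ (X' q₀) := chartDeriv_mlieBracket S X
  have b2 : chartDeriv 𝓘(ℝ, E).tangent w w
      (VectorField.mlieBracket 𝓘(ℝ, E).tangent S (Finsler.almostTangent X) w)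
      = fderiv ℝ (coordField 𝓘(ℝ, E).tangent w (Finsler.almostTangent X)) q₀ (S' q₀)
        - fderiv ℝ S' q₀ (coordField 𝓘(ℝ, E).tangent w (Finsler.almostTangent X) q₀) :=
    chartDeriv_mlieBracket S (Finsler.almostTangent X)
  have hN : ∀ u, sprayCoeff S w u = (fderiv ℝ S' q₀ (0, u)).2 := fun _ => rfl
  rw [hJ.fderiv_eq, hJ.eq_of_nhds] at b2
  have e : chartDeriv 𝓘(ℝ, E).tangent w w (grifone S X w)
      = chartDeriv 𝓘(ℝ, E).tangent w w
          (Finsler.almostTangent (VectorField.mlieBracket 𝓘(ℝ, E).tangent S X) w)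
        - chartDeriv 𝓘(ℝ, E).tangent w w
          (VectorField.mlieBracket 𝓘(ℝ, E).tangent S (Finsler.almostTangent X) w) :=
    map_sub _ _ _
  rw [e, chartDeriv_almostTangent hw', b1, b2]
  have dJ' : ∀ v, fderiv ℝ (fun q => ((ContinuousLinearMap.inr ℝ E E).comp
      (ContinuousLinearMap.fst ℝ E E)) (X' q)) q₀ v = (0, (fderiv ℝ X' q₀ v).1) := fun v =>
    DFunLike.congr_fun dJ v
  rw [dJ', ← hX0, hN]
  clear_value q₀ S' X'
  refine Prod.ext ?_ ?_
  · simp [hS1]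
  · simp [hS1]

/-! ### Horizontal lifts of vectors and of vector fields -/

section HorizontalLift

variable {E : Type*} [NormedAddCommGroup E] [NormedSpace ℝ E]
  {M : Type*} [TopologicalSpace M] [ChartedSpace E M] [IsManifold 𝓘(ℝ, E) ∞ M]
  {w z : TangentBundle 𝓘(ℝ, E) M} {S X : FieldTM E M}

/-- Writing $N$ for `sprayCoeff`, $\Gamma_S(a,b) = (a, Na - b)$ fixes $(a,b)$ exactly when $b =
\tfrac12Na$. The existential over extensions becomes a linear condition. -/
lemma IsSemispray.isHorizontal_iff (hS : IsSemispray S) (hw : w ∈ slit E M)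
    (h : TangentSpace 𝓘(ℝ, E).tangent w) :
    IsHorizontal S w h ↔ (chartDeriv 𝓘(ℝ, E).tangent w w h).2
      = (2⁻¹ : ℝ) • sprayCoeff S w (chartDeriv 𝓘(ℝ, E).tangent w w h).1 := by
  have hw' := mem_chart_source (ModelProd E E) w
  constructor
  · rintro ⟨U, X, hU, -, hwU, hX, rfl, hΓ⟩
    have h1 := hS.chartDeriv_grifone hw (hX.smoothFieldAt hU hwU)
    rw [hΓ] at h1
    have h2 := (Prod.ext_iff.1 h1).2
    rw [eq_inv_smul_iff₀ two_ne_zero, two_smul]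
    exact eq_sub_iff_add_eq.1 h2
  · intro h1
    obtain ⟨X, hX, hXw⟩ := exists_smoothFieldOn_extension (I := 𝓘(ℝ, E).tangent) w h
    have hU := (chartAt (ModelProd E E) w).open_source
    refine ⟨_, X, hU.inter isOpen_slit, inter_subset_right, ⟨hw', hw⟩,
      hX.mono inter_subset_left, hXw, ?_⟩
    apply chartDeriv_injective hw'
    rw [hS.chartDeriv_grifone hw (hX.smoothFieldAt hU hw'), hXw]
    refine Prod.ext rfl ?_
    rw [eq_inv_smul_iff₀ two_ne_zero, two_smul] at h1
    exact (eq_sub_iff_add_eq.2 h1).symm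

lemma IsSemispray.hlift_spec (hS : IsSemispray S) (hw : w ∈ slit E M)
    (u : TangentSpace 𝓘(ℝ, E) w.proj) :
    dproj w (hlift S w u) = u ∧ IsHorizontal S w (hlift S w u) := by
  have hw' := mem_chart_source (ModelProd E E) w
  have hx := mem_chart_source E w.proj
  have : ∃ L : TangentSpace 𝓘(ℝ, E) w.proj →L[ℝ] TangentSpace 𝓘(ℝ, E).tangent w,
      ∀ u, dproj w (L u) = u ∧ IsHorizontal S w (L u) := by
    -- `hlift` is a choice, so existence has to be shown; in coordinates the map is $u \mapsto (u,
    -- \tfrac12Nu)$.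
    refine ⟨(chartDerivSymm 𝓘(ℝ, E).tangent w w).comp
      (((ContinuousLinearMap.id ℝ E).prod ((2⁻¹ : ℝ) • sprayCoeff S w)).comp
        (chartDeriv 𝓘(ℝ, E) w.proj w.proj)), fun u => ⟨?_, ?_⟩⟩
    · apply chartDeriv_injective (I := 𝓘(ℝ, E)) hx
      rw [← chartDeriv_fst hx]
      simp only [ContinuousLinearMap.comp_apply]
      rw [chartDeriv_chartDerivSymm hw']
      simp
    · rw [hS.isHorizontal_iff hw]
      simp only [ContinuousLinearMap.comp_apply]
      rw [chartDeriv_chartDerivSymm hw']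
      simp
  exact Classical.epsilon_spec this u

lemma IsSemispray.dproj_hlift (hS : IsSemispray S) (hw : w ∈ slit E M)
    (u : TangentSpace 𝓘(ℝ, E) w.proj) : dproj w (hlift S w u) = u :=
  (hS.hlift_spec hw u).1

lemma IsSemispray.chartDeriv_hlift (hS : IsSemispray S) (hw : w ∈ slit E M)
    (u : TangentSpace 𝓘(ℝ, E) w.proj) :
    chartDeriv 𝓘(ℝ, E).tangent w w (hlift S w u) = (chartDeriv 𝓘(ℝ, E) w.proj w.proj u,
      (2⁻¹ : ℝ) • sprayCoeff S w (chartDeriv 𝓘(ℝ, E) w.proj w.proj u)) := by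
  obtain ⟨h1, h2⟩ := hS.hlift_spec hw u
  have h3 := chartDeriv_fst (mem_chart_source E w.proj) (hlift S w u)
  rw [h1] at h3
  rw [hS.isHorizontal_iff hw, h3] at h2
  exact Prod.ext h3 h2

lemma IsSemispray.horPart_eq (hS : IsSemispray S) (hw : w ∈ slit E M)
    (hX : SmoothFieldAt 𝓘(ℝ, E).tangent X w) :
    horPart S X w = hlift S w (dproj w (X w)) := by
  apply chartDeriv_injective (I := 𝓘(ℝ, E).tangent) (mem_chart_source (ModelProd E E) w)
  rw [hS.chartDeriv_hlift hw, horPart, map_smul, map_add, hS.chartDeriv_grifone hw hX,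
    ← chartDeriv_fst (mem_chart_source E w.proj)]
  refine Prod.ext ?_ ?_
  · simp only [Prod.smul_fst, Prod.fst_add]
    rw [← two_smul ℝ, smul_smul]
    norm_num
  · simp only [Prod.smul_snd, Prod.snd_add]
    rw [add_sub_cancel]

lemma verPart_eq_sub (w : TangentBundle 𝓘(ℝ, E) M) :
    verPart S X w = X w - horPart S X w := by
  have h : X w = (2⁻¹ : ℝ) • (X w + X w) := by
    rw [← two_smul ℝ (X w), smul_smul]
    norm_num
  rw [verPart, horPart, eq_sub_iff_add_eq, ← smul_add, sub_add_add_cancel, ← h]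

lemma IsSemispray.verPart_eq (hS : IsSemispray S) (hw : w ∈ slit E M)
    (hX : SmoothFieldAt 𝓘(ℝ, E).tangent X w) :
    verPart S X w = X w - hlift S w (dproj w (X w)) := by
  rw [verPart_eq_sub, hS.horPart_eq hw hX]

lemma vlift_zero (w : TangentBundle 𝓘(ℝ, E) M) : vlift w 0 = 0 := by
  apply chartDeriv_injective (I := 𝓘(ℝ, E).tangent) (mem_chart_source (ModelProd E E) w)
  rw [chartDeriv_vlift (mem_chart_source E w.proj), map_zero, map_zero]
  rfl

lemma exists_eq_vlift {ξ : TangentSpace 𝓘(ℝ, E).tangent w} (h : dproj w ξ = 0) :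
    ∃ v, ξ = vlift w v := by
  have hx := mem_chart_source E w.proj
  refine ⟨chartDerivSymm 𝓘(ℝ, E) w.proj w.proj (chartDeriv 𝓘(ℝ, E).tangent w w ξ).2, ?_⟩
  apply chartDeriv_injective (I := 𝓘(ℝ, E).tangent) (mem_chart_source (ModelProd E E) w)
  rw [chartDeriv_vlift hx, chartDeriv_chartDerivSymm hx]
  refine Prod.ext ?_ rfl
  rw [chartDeriv_fst hx, h, map_zero]

lemma vliftInv_zero (w : TangentBundle 𝓘(ℝ, E) M) : vliftInv w 0 = 0 := by
  have h := Function.leftInverse_invFun (vlift_injective w) 0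
  rwa [vlift_zero] at h

variable [FiniteDimensional ℝ E]

lemma IsSemispray.smoothFieldAt_horPart (hS : IsSemispray S) (hw : w ∈ slit E M)
    (hX : SmoothFieldAt 𝓘(ℝ, E).tangent X w) :
    SmoothFieldAt 𝓘(ℝ, E).tangent (horPart S X) w := by
  have : IsManifold 𝓘(ℝ, E).tangent (minSmoothness ℝ 2) (TangentBundle 𝓘(ℝ, E) M) := by
    rw [minSmoothness_of_isRCLikeNormedField]
    infer_instance
  -- The bracket costs one derivative, and $\infty + 1$ is again $\infty$.
  have : IsManifold 𝓘(ℝ, E).tangent (∞ + 1) (TangentBundle 𝓘(ℝ, E) M) :=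
    inferInstanceAs (IsManifold 𝓘(ℝ, E).tangent ∞ (TangentBundle 𝓘(ℝ, E) M))
  have hSw := hS.smoothFieldAt hw
  have h1 : SmoothFieldAt 𝓘(ℝ, E).tangent (VectorField.mlieBracket 𝓘(ℝ, E).tangent S X) w :=
    ContMDiffAt.mlieBracket_vectorField (n := ⊤) hSw hX (by simp)
  have h2 : SmoothFieldAt 𝓘(ℝ, E).tangent
      (VectorField.mlieBracket 𝓘(ℝ, E).tangent S (almostTangent X)) w :=
    ContMDiffAt.mlieBracket_vectorField (n := ⊤) hSw hX.almostTangent (by simp)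
  exact ContMDiffAt.const_smul_section (a := (2⁻¹ : ℝ))
    (ContMDiffAt.add_section hX (ContMDiffAt.sub_section h1.almostTangent h2))

/-- The horizontal lift of the vector field `U`. -/
def hliftField (S : FieldTM E M) (U : Π x : M, TangentSpace 𝓘(ℝ, E) x) : FieldTM E M :=
  fun z => hlift S z (U z.proj)

/-- The open set of nonzero vectors with foot point in `O`. -/
def slitOver (O : Set M) : Set (TangentBundle 𝓘(ℝ, E) M) := {z | z.proj ∈ O} ∩ slit E M

lemma isOpen_slitOver {O : Set M} (hO : IsOpen O) :
    IsOpen (slitOver O : Set (TangentBundle 𝓘(ℝ, E) M)) :=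
  (isOpen_preimage_proj hO).inter isOpen_slit

/-- `hlift` is chosen separately at each point, so its smoothness comes from elsewhere: if $X$ is
smooth with $d\pi(X) = U$, then $\mathscr HX = U^{\mathfrak h}$, and $\mathscr HX$ is smooth because
it is made of brackets with $S$. The field with coordinates $(U, 0)$ serves as $X$. -/
lemma IsSemispray.smoothFieldOn_hliftField (hS : IsSemispray S) {O : Set M} (hO : IsOpen O)
    {U : Π x : M, TangentSpace 𝓘(ℝ, E) x} (hU : SmoothFieldOn 𝓘(ℝ, E) U O) :
    SmoothFieldOn 𝓘(ℝ, E).tangent (hliftField S U) (slitOver O) := by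
  refine smoothFieldOn_of_forall fun w hw => ?_
  have hx := mem_chart_source E w.proj
  have hwc := mem_chart_source (ModelProd E E) w
  set X : FieldTM E M := fun z => chartDerivSymm 𝓘(ℝ, E).tangent w z
    ((chartDeriv 𝓘(ℝ, E) w.proj z.proj (U z.proj), 0) : E × E) with hX
  have hXs : ∀ z ∈ (chartAt (ModelProd E E) w).source ∩ slitOver O,
      SmoothFieldAt 𝓘(ℝ, E).tangent X z := fun z hz => by
    refine smoothFieldAt_chartDerivSymm hz.1 ?_
    have h1 := (smoothFieldAt_iff (mem_chart_tangent_source.1 hz.1)).1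
      (hU.smoothFieldAt hO hz.2.1)
    exact (ContinuousLinearMap.inl ℝ E E).contMDiff.contMDiffAt.comp z
      (h1.comp z contMDiffAt_proj_tangent)
  have hopen : IsOpen ((chartAt (ModelProd E E) w).source ∩ slitOver O) :=
    (chartAt (ModelProd E E) w).open_source.inter (isOpen_slitOver hO)
  refine (hS.smoothFieldAt_horPart hw.2 (hXs w ⟨hwc, hw⟩)).congr_of_eventuallyEq ?_
  filter_upwards [hopen.mem_nhds ⟨hwc, hw⟩] with z hz
  have hzc := mem_chart_tangent_source.1 hz.1
  have h2 : dproj z (X z) = U z.proj := by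
    apply chartDeriv_injective (I := 𝓘(ℝ, E)) hzc
    rw [← chartDeriv_fst hzc, hX, chartDeriv_chartDerivSymm hz.1]
  rw [hS.horPart_eq hz.2.2 (hXs z hz), h2]
  rfl

lemma IsSemispray.dproj_hliftField (hS : IsSemispray S) (hw : w ∈ slit E M)
    (U : Π x : M, TangentSpace 𝓘(ℝ, E) x) : dproj w (hliftField S U w) = U w.proj :=
  hS.dproj_hlift hw _

end HorizontalLift

/-! ### Locality of vertical connections and derivatives along a vector field -/

section VerticalConnections

variable {E : Type*} [NormedAddCommGroup E] [NormedSpace ℝ E]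
  {M : Type*} [TopologicalSpace M] [ChartedSpace E M] [IsManifold 𝓘(ℝ, E) ∞ M]
  {w z : TangentBundle 𝓘(ℝ, E) M} {x₀ : M} {S X : FieldTM E M} {Y Y' : VertSection E M}
  {nabla : VertOperator E M}

lemma VertSection.diffAt_iff (hx : w.proj ∈ (chartAt E x₀).source) :
    Y.DiffAt w ↔ MDifferentiableAt 𝓘(ℝ, E).tangent 𝓘(ℝ, E)
      (fun z => chartDeriv 𝓘(ℝ, E) x₀ z.proj (Y z)) w :=
  (mdifferentiableAt_tangent_iff (f := Y.toMap) hx).trans (and_iff_right mdifferentiableAt_proj)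

lemma VertSection.DiffAt.congr (hY : Y.DiffAt w) (h : ∀ᶠ z in 𝓝 w, Y z = Y' z) : Y'.DiffAt w := by
  refine MDifferentiableAt.congr_of_eventuallyEq hY ?_
  filter_upwards [h] with z hz
  simp only [VertSection.toMap, hz]

lemma VertSection.diffAt_zero : VertSection.DiffAt (0 : VertSection E M) w := by
  rw [VertSection.diffAt_iff (mem_chart_source E w.proj)]
  simp only [Pi.zero_apply, map_zero]
  exact mdifferentiableAt_const

lemma VertSection.DiffAt.add (hY : Y.DiffAt w) (hY' : Y'.DiffAt w) :
    VertSection.DiffAt (Y + Y') w := by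
  rw [VertSection.diffAt_iff (mem_chart_source E w.proj)] at *
  simp only [Pi.add_apply, map_add]
  exact MDifferentiableAt.add hY hY'

lemma VertSection.DiffAt.sub (hY : Y.DiffAt w) (hY' : Y'.DiffAt w) :
    VertSection.DiffAt (Y - Y') w := by
  rw [VertSection.diffAt_iff (mem_chart_source E w.proj)] at *
  simp only [Pi.sub_apply, map_sub]
  exact MDifferentiableAt.sub hY hY'

lemma VertSection.DiffAt.smul {f : TangentBundle 𝓘(ℝ, E) M → ℝ}
    (hf : MDifferentiableAt 𝓘(ℝ, E).tangent 𝓘(ℝ, ℝ) f w) (hY : Y.DiffAt w) :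
    VertSection.DiffAt (fun z => f z • Y z) w := by
  rw [VertSection.diffAt_iff (mem_chart_source E w.proj)] at *
  simp only [map_smul]
  exact MDifferentiableAt.smul hf hY

lemma diffAt_canon : VertSection.DiffAt (canon : VertSection E M) w :=
  mdifferentiableAt_id

lemma diffAt_pullField {V : Π x : M, TangentSpace 𝓘(ℝ, E) x}
    (hV : MDifferentiableAt 𝓘(ℝ, E) 𝓘(ℝ, E).tangent
      (fun x => (⟨x, V x⟩ : TangentBundle 𝓘(ℝ, E) M)) w.proj) : (pullField V).DiffAt w :=
  hV.comp w mdifferentiableAt_proj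

lemma smoothOn_pullField {V : Π x : M, TangentSpace 𝓘(ℝ, E) x} {O : Set M}
    (hV : SmoothFieldOn 𝓘(ℝ, E) V O) : (pullField V).SmoothOn (slitOver O) :=
  ContMDiffOn.comp (t := O) hV (fun _ _ => contMDiffAt_proj_tangent.contMDiffWithinAt)
    fun _ hz => hz.1

namespace IsVertConnection

/-- The Leibniz rule asks only for differentiability at $w$, so the indicator of $\{Y = Y'\}$ serves
as a cut-off: it is $1$ near $w$, and its products with $Y$ and $Y'$ coincide everywhere. -/
lemma congr (h : IsVertConnection nabla) (hw : w ∈ slit E M) (hY : Y.DiffAt w)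
    (hYY' : ∀ᶠ z in 𝓝 w, Y z = Y' z) : nabla Y w = nabla Y' w := by
  classical
  set f : TangentBundle 𝓘(ℝ, E) M → ℝ := fun z => if Y z = Y' z then 1 else 0 with hf
  have hf1 : f =ᶠ[𝓝 w] fun _ => 1 := by
    filter_upwards [hYY'] with z hz
    simp [hf, hz]
  have hfd : MDifferentiableAt 𝓘(ℝ, E).tangent 𝓘(ℝ, ℝ) f w :=
    mdifferentiableAt_const.congr_of_eventuallyEq hf1
  have hd : ∀ ξ, dirDeriv 𝓘(ℝ, E).tangent f w ξ = 0 := fun ξ => by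
    rw [dirDeriv, mvfderiv, hf1.mfderiv_eq, mfderiv_const]
    rfl
  have heq : (fun z => f z • Y z) = fun z => f z • Y' z := by
    funext z
    by_cases hz : Y z = Y' z
    · rw [hz]
    · simp [hf, hz]
  have key : ∀ Z : VertSection E M, Z.DiffAt w → nabla (fun z => f z • Z z) w = nabla Z w := by
    intro Z hZ
    ext ξ
    rw [h.leibniz f Z w hw hfd hZ ξ, hd, hf1.eq_of_nhds, one_smul, zero_smul, add_zero]
  rw [← key Y hY, ← key Y' (hY.congr hYY'), heq]

lemma zero (h : IsVertConnection nabla) (hw : w ∈ slit E M) : nabla 0 w = 0 := by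
  have h1 := h.add 0 0 w hw VertSection.diffAt_zero VertSection.diffAt_zero
  rwa [add_zero, right_eq_add] at h1

lemma sum (h : IsVertConnection nabla) (hw : w ∈ slit E M) {ι : Type*} (s : Finset ι)
    (A : ι → VertSection E M) (hA : ∀ i, (A i).DiffAt w) :
    VertSection.DiffAt (∑ i ∈ s, A i) w ∧ nabla (∑ i ∈ s, A i) w = ∑ i ∈ s, nabla (A i) w := by
  classical
  induction s using Finset.induction_on with
  | empty => exact ⟨VertSection.diffAt_zero, h.zero hw⟩
  | insert i s hi ih =>
    rw [Finset.sum_insert hi, Finset.sum_insert hi]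
    exact ⟨(hA i).add ih.1, by rw [h.add _ _ w hw (hA i) ih.1, ih.2]⟩

/-- A covariant derivative of a section vanishing at `w` vanishes in the directions in which
the coordinates of the section are stationary. -/
lemma eq_zero_of_stationary [FiniteDimensional ℝ E] (h : IsVertConnection nabla)
    (hw : w ∈ slit E M) (hY : Y.DiffAt w) (h0 : Y w = 0) {ξ : TangentSpace 𝓘(ℝ, E).tangent w}
    (hξ : mvfderiv 𝓘(ℝ, E).tangent (fun z => chartDeriv 𝓘(ℝ, E) w.proj z.proj (Y z)) w ξ = 0) :
    nabla Y w ξ = 0 := by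
  have hx := mem_chart_source E w.proj
  set b := Module.finBasis ℝ E
  set g : TangentBundle 𝓘(ℝ, E) M → E := fun z => chartDeriv 𝓘(ℝ, E) w.proj z.proj (Y z) with hg
  have hgd : MDifferentiableAt 𝓘(ℝ, E).tangent 𝓘(ℝ, E) g w := (VertSection.diffAt_iff hx).1 hY
  set l : Fin (Module.finrank ℝ E) → E →L[ℝ] ℝ := fun i => (b.coord i).toContinuousLinearMap
  set A : Fin (Module.finrank ℝ E) → VertSection E M :=
    fun i z => chartDerivSymm 𝓘(ℝ, E) w.proj z.proj (b i) with hA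
  have hAd : ∀ i, (A i).DiffAt w := fun i => diffAt_pullField
    (V := fun x => chartDerivSymm 𝓘(ℝ, E) w.proj x (b i))
    (smoothFieldAt_chartDerivSymm hx contMDiffAt_const).mdifferentiableAt
  have hl : ∀ i, HasMFDerivAt 𝓘(ℝ, E).tangent 𝓘(ℝ, ℝ) (fun z => l i (g z)) w
      ((l i).comp (mfderiv 𝓘(ℝ, E).tangent 𝓘(ℝ, E) g w)) := fun i =>
    HasMFDerivAt.comp w (l i).hasFDerivAt.hasMFDerivAt hgd.hasMFDerivAt
  -- Near $w$ the section is expanded in a frame with constant coordinates. In the Leibniz rule,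
  -- both the coefficients at $w$ and their derivatives along $\xi$ vanish.
  set B : Fin (Module.finrank ℝ E) → VertSection E M := fun i z => l i (g z) • A i z with hB
  have hYA : ∀ᶠ z in 𝓝 w, Y z = (∑ i, B i : VertSection E M) z := by
    filter_upwards [(isOpen_preimage_proj (chartAt E w.proj).open_source).mem_nhds hx] with z hz
    rw [Finset.sum_apply]
    have h1 : ∑ i, l i (g z) • b i = g z := b.sum_repr (g z)
    rw [← chartDerivSymm_chartDeriv (I := 𝓘(ℝ, E)) hz (Y z)]
    refine (congrArg (chartDerivSymm 𝓘(ℝ, E) w.proj z.proj) h1.symm).trans ?_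
    rw [map_sum]
    simp only [map_smul, hA, hB]
  have hsum := h.sum hw Finset.univ B
    fun i => (hAd i).smul (hl i).mdifferentiableAt
  rw [h.congr hw hY hYA, hsum.2, sum_apply]
  refine Finset.sum_eq_zero fun i _ => ?_
  rw [h.leibniz _ _ w hw (hl i).mdifferentiableAt (hAd i) ξ]
  have h1 : g w = 0 := by rw [hg]; simp only [h0, map_zero]
  have h2 : dirDeriv 𝓘(ℝ, E).tangent (fun z => l i (g z)) w ξ = 0 := by
    have h3 : dirDeriv 𝓘(ℝ, E).tangent (fun z => l i (g z)) w ξ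
        = l i (mvfderiv 𝓘(ℝ, E).tangent g w ξ) :=
      DFunLike.congr_fun (hl i).mfderiv ξ
    rw [h3, hξ, map_zero]
  rw [h2, h1, map_zero, zero_smul, zero_smul, add_zero]

end IsVertConnection

/-- A vector field as a map to the tangent bundle. -/
def sectionMap (W : Π x : M, TangentSpace 𝓘(ℝ, E) x) (x : M) : TangentBundle 𝓘(ℝ, E) M :=
  ⟨x, W x⟩

/-- The differential of a vector field, as a map to the tangent bundle. -/
def sectionDeriv (W : Π x : M, TangentSpace 𝓘(ℝ, E) x) (x : M) (u : TangentSpace 𝓘(ℝ, E) x) :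
    TangentSpace 𝓘(ℝ, E).tangent (⟨x, W x⟩ : TangentBundle 𝓘(ℝ, E) M) :=
  mfderiv 𝓘(ℝ, E) 𝓘(ℝ, E).tangent (sectionMap W) x u

variable {W : Π x : M, TangentSpace 𝓘(ℝ, E) x} {x : M}

lemma dproj_sectionDeriv (hW : SmoothFieldAt 𝓘(ℝ, E) W x) (u : TangentSpace 𝓘(ℝ, E) x) :
    dproj ⟨x, W x⟩ (sectionDeriv W x u) = u := by
  have h1 := HasMFDerivAt.comp x (g := fun z : TangentBundle 𝓘(ℝ, E) M => z.proj)
    (f := sectionMap W) mdifferentiableAt_proj.hasMFDerivAt hW.mdifferentiableAt.hasMFDerivAt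
  exact DFunLike.congr_fun (hasMFDerivAt_unique h1 (hasMFDerivAt_id x)) u

lemma dirDeriv_sectionDeriv (hW : SmoothFieldAt 𝓘(ℝ, E) W x)
    {V' : Type*} [NormedAddCommGroup V'] [NormedSpace ℝ V']
    {f : TangentBundle 𝓘(ℝ, E) M → V'}
    (hf : MDifferentiableAt 𝓘(ℝ, E).tangent 𝓘(ℝ, V') f ⟨x, W x⟩) (u : TangentSpace 𝓘(ℝ, E) x) :
    mvfderiv 𝓘(ℝ, E) (fun y => f ⟨y, W y⟩) x u
      = mvfderiv 𝓘(ℝ, E).tangent f ⟨x, W x⟩ (sectionDeriv W x u) := by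
  have h1 := HasMFDerivAt.comp x (g := f)
    (f := sectionMap W) hf.hasMFDerivAt hW.mdifferentiableAt.hasMFDerivAt
  exact DFunLike.congr_fun h1.mfderiv u

lemma dirDeriv_comp_proj {f : M → ℝ} (hf : MDifferentiableAt 𝓘(ℝ, E) 𝓘(ℝ, ℝ) f w.proj)
    (ξ : TangentSpace 𝓘(ℝ, E).tangent w) :
    dirDeriv 𝓘(ℝ, E).tangent (fun z => f z.proj) w ξ = mvfderiv 𝓘(ℝ, E) f w.proj (dproj w ξ) := by
  have h1 := HasMFDerivAt.comp w (g := f) (f := fun z : TangentBundle 𝓘(ℝ, E) M => z.proj)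
    hf.hasMFDerivAt mdifferentiableAt_proj.hasMFDerivAt
  exact DFunLike.congr_fun h1.mfderiv ξ

/-- The section $W^{\mathfrak v} - C$ vanishes on the whole image of $W$, so it is zero at $W(x)$
and stationary in the direction $W_*u$. -/
lemma IsVertConnection.pullField_sectionDeriv [FiniteDimensional ℝ E] (h : IsVertConnection nabla)
    (hW : SmoothFieldAt 𝓘(ℝ, E) W x) (hx : W x ≠ 0) (u : TangentSpace 𝓘(ℝ, E) x) :
    nabla (pullField W) ⟨x, W x⟩ (sectionDeriv W x u)
      = nabla canon ⟨x, W x⟩ (sectionDeriv W x u) := by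
  have hd : (pullField W).DiffAt ⟨x, W x⟩ := diffAt_pullField hW.mdifferentiableAt
  have hd' := hd.sub diffAt_canon
  have h1 := h.add (pullField W - canon) canon ⟨x, W x⟩ hx hd' diffAt_canon
  rw [sub_add_cancel] at h1
  rw [h1, add_apply, h.eq_zero_of_stationary (Y := pullField W - canon) hx hd',
    zero_add]
  · exact sub_self (W x)
  · rw [← dirDeriv_sectionDeriv hW ((VertSection.diffAt_iff (mem_chart_source E x)).1 hd')]
    have h2 : (fun y => chartDeriv 𝓘(ℝ, E) x y
        ((pullField W - canon : VertSection E M) ⟨y, W y⟩)) = fun _ => 0 := by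
      funext y
      have : (pullField W - canon : VertSection E M) ⟨y, W y⟩ = 0 := sub_self (W y)
      rw [this, map_zero]
    rw [h2, mvfderiv_const]
    rfl

end VerticalConnections

/-! ### Torsion on projectable fields and the affine connections $D^W$ -/

section AffineFamily

variable {E : Type*} [NormedAddCommGroup E] [NormedSpace ℝ E]
  {M : Type*} [TopologicalSpace M] [ChartedSpace E M] [IsManifold 𝓘(ℝ, E) ∞ M]
  {w z : TangentBundle 𝓘(ℝ, E) M} {S X Y : FieldTM E M}
  {nabla : VertOperator E M} {O : Set M} {U V W : Π x : M, TangentSpace 𝓘(ℝ, E) x} {x : M}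

/-- Brackets of projectable fields project to brackets. -/
lemma dproj_mlieBracket (hX : ∀ᶠ z in 𝓝 w, dproj z (X z) = U z.proj)
    (hY : ∀ᶠ z in 𝓝 w, dproj z (Y z) = V z.proj)
    (hXs : SmoothFieldAt 𝓘(ℝ, E).tangent X w) (hYs : SmoothFieldAt 𝓘(ℝ, E).tangent Y w)
    (hU : SmoothFieldAt 𝓘(ℝ, E) U w.proj) (hV : SmoothFieldAt 𝓘(ℝ, E) V w.proj) :
    dproj w (VectorField.mlieBracket 𝓘(ℝ, E).tangent X Y w)
      = VectorField.mlieBracket 𝓘(ℝ, E) U V w.proj := by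
  have hx := mem_chart_source E w.proj
  apply chartDeriv_injective (I := 𝓘(ℝ, E)) hx
  rw [← chartDeriv_fst hx, chartDeriv_mlieBracket, chartDeriv_mlieBracket]
  set q₀ := extChartAt 𝓘(ℝ, E).tangent w w with hq₀
  have hq₁ : extChartAt 𝓘(ℝ, E) w.proj w.proj = q₀.1 := rfl
  -- A field over $U$ has first component $U \circ \mathrm{pr}_1$ in natural coordinates, so its
  -- vertical component never enters the first component of a bracket.
  have key : ∀ {X : FieldTM E M} {U : Π x : M, TangentSpace 𝓘(ℝ, E) x},
      (∀ᶠ z in 𝓝 w, dproj z (X z) = U z.proj) →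
      (fun q => (coordField 𝓘(ℝ, E).tangent w X q).1)
        =ᶠ[𝓝 q₀] fun q => coordField 𝓘(ℝ, E) w.proj U q.1 := by
    intro X U h
    have h1 := (continuousAt_extChartAt_symm (I := 𝓘(ℝ, E).tangent) w).eventually
      (by rw [extChartAt_to_inv]; exact h)
    filter_upwards [eventually_chart_symm_mem (I := 𝓘(ℝ, E).tangent) w, h1] with q hq hq1
    have hz := mem_chart_tangent_source.1 hq.2
    refine (chartDeriv_fst hz _).trans ?_
    rw [hq1, coordField]
    have h2 : ((extChartAt 𝓘(ℝ, E).tangent w).symm q).proj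
        = (extChartAt 𝓘(ℝ, E) w.proj).symm q.1 := by
      have h3 : extChartAt 𝓘(ℝ, E) w.proj ((extChartAt 𝓘(ℝ, E).tangent w).symm q).proj = q.1 :=
        congrArg Prod.fst ((extChartAt 𝓘(ℝ, E).tangent w).right_inv hq.1)
      rw [← h3, (extChartAt 𝓘(ℝ, E) w.proj).left_inv (by simpa using hz)]
    rw [h2]
  have fd : ∀ {X : FieldTM E M} {U : Π x : M, TangentSpace 𝓘(ℝ, E) x},
      (∀ᶠ z in 𝓝 w, dproj z (X z) = U z.proj) → SmoothFieldAt 𝓘(ℝ, E).tangent X w →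
      SmoothFieldAt 𝓘(ℝ, E) U w.proj → ∀ v : E × E,
      (fderiv ℝ (coordField 𝓘(ℝ, E).tangent w X) q₀ v).1
        = fderiv ℝ (coordField 𝓘(ℝ, E) w.proj U) q₀.1 v.1 := by
    intro X U h hXs hU v
    have dX := differentiableAt_coordField hXs.mdifferentiableAt
    have dU : DifferentiableAt ℝ (coordField 𝓘(ℝ, E) w.proj U) q₀.1 :=
      differentiableAt_coordField hU.mdifferentiableAt
    have h1 := (key h).fderiv_eq (𝕜 := ℝ)
    have h2 := ((ContinuousLinearMap.fst ℝ E E).hasFDerivAt.comp q₀ dX.hasFDerivAt).fderiv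
    have h3 := (dU.hasFDerivAt.comp q₀ ((ContinuousLinearMap.fst ℝ E E).hasFDerivAt)).fderiv
    exact DFunLike.congr_fun (h2.symm.trans (h1.trans h3)) v
  rw [VectorField.lieBracket_eq, VectorField.lieBracket_eq, hq₁]
  simp only [Prod.fst_sub]
  rw [fd hX hXs hU, fd hY hYs hV, (key hX).eq_of_nhds, (key hY).eq_of_nhds]

lemma IsVertConnection.torsion_eq (h : IsVertConnection nabla) (hw : w ∈ slit E M)
    (hX : ∀ᶠ z in 𝓝 w, dproj z (X z) = U z.proj)
    (hY : ∀ᶠ z in 𝓝 w, dproj z (Y z) = V z.proj)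
    (hXs : SmoothFieldAt 𝓘(ℝ, E).tangent X w) (hYs : SmoothFieldAt 𝓘(ℝ, E).tangent Y w)
    (hU : SmoothFieldAt 𝓘(ℝ, E) U w.proj) (hV : SmoothFieldAt 𝓘(ℝ, E) V w.proj) :
    torsion nabla X Y w = nabla (pullField V) w (X w) - nabla (pullField U) w (Y w)
      - VectorField.mlieBracket 𝓘(ℝ, E) U V w.proj := by
  rw [torsion, dproj_mlieBracket hX hY hXs hYs hU hV,
    ← h.congr (Y' := projField X) hw (diffAt_pullField hU.mdifferentiableAt) (hX.mono fun z hz => hz.symm),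
    ← h.congr (Y' := projField Y) hw (diffAt_pullField hV.mdifferentiableAt) (hY.mono fun z hz => hz.symm)]

lemma smoothFieldAt_zero : SmoothFieldAt 𝓘(ℝ, E) (0 : Π x : M, TangentSpace 𝓘(ℝ, E) x) x := by
  rw [smoothFieldAt_iff (mem_chart_source E x)]
  simp only [Pi.zero_apply, map_zero]
  exact contMDiffAt_const

/-- The torsion in a vertical direction. -/
lemma IsVertConnection.torsion_almostTangent (h : IsVertConnection nabla) (hw : w ∈ slit E M)
    (hY : ∀ᶠ z in 𝓝 w, dproj z (Y z) = V z.proj)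
    (hXs : SmoothFieldAt 𝓘(ℝ, E).tangent X w) (hYs : SmoothFieldAt 𝓘(ℝ, E).tangent Y w)
    (hV : SmoothFieldAt 𝓘(ℝ, E) V w.proj) :
    torsion nabla (almostTangent X) Y w = nabla (pullField V) w (almostTangent X w) := by
  have h0 : pullField (0 : Π x : M, TangentSpace 𝓘(ℝ, E) x) = 0 := rfl
  -- $\mathscr JX$ projects to the zero field, so the second covariant derivative and the bracket on
  -- $M$ both vanish.
  rw [h.torsion_eq (X := almostTangent X) hw (U := 0) (.of_forall fun z => dproj_vlift z _) hY hXs.almostTangent hYs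
    smoothFieldAt_zero hV, h0, h.zero hw, VectorField.mlieBracket_zero_left]
  simp

variable [FiniteDimensional ℝ E]

lemma sectionMap_mem_slitOver (hx : x ∈ O) (hW0 : ∀ x ∈ O, W x ≠ 0) :
    (⟨x, W x⟩ : TangentBundle 𝓘(ℝ, E) M) ∈ (slitOver O : Set (TangentBundle 𝓘(ℝ, E) M)) :=
  ⟨hx, hW0 x hx⟩

/-- In the Leibniz rule for $f \circ \pi$, $d\pi(u^{\mathfrak h}) = u$ turns the derivative along
$u^{\mathfrak h}$ into $u(f)$. Smoothness follows by composing the section $\nabla_{U^{\mathfrak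
h}}V^{\mathfrak v}$ with the smooth map $W$. -/
lemma IsSemispray.isAffineConnectionOn (hS : IsSemispray S) (h : IsVertConnection nabla)
    (hW : SmoothFieldOn 𝓘(ℝ, E) W O) (hW0 : ∀ x ∈ O, W x ≠ 0) :
    IsAffineConnectionOn O (affineFamily S nabla W) where
  isCovariantDerivativeOn :=
    { add := by
        intro σ σ' x hσ hσ' hx
        have h1 := h.add (pullField σ) (pullField σ') ⟨x, W x⟩ (hW0 x hx)
          (diffAt_pullField hσ) (diffAt_pullField hσ')
        ext u
        exact DFunLike.congr_fun h1 (hlift S ⟨x, W x⟩ u)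
      leibniz := by
        intro σ g x hσ hg hx
        ext u
        have h1 := h.leibniz (fun z => g z.proj) (pullField σ) ⟨x, W x⟩ (hW0 x hx)
          (hg.comp (⟨x, W x⟩ : TangentBundle 𝓘(ℝ, E) M) mdifferentiableAt_proj)
          (diffAt_pullField hσ) (hlift S ⟨x, W x⟩ u)
        rw [dirDeriv_comp_proj hg, hS.dproj_hlift (hW0 x hx)] at h1
        exact h1 }
  smooth := by
    intro O' U V hO' hO'O hU hV
    have h1 := h.smooth (slitOver O') (hliftField S U) (pullField V) (isOpen_slitOver hO')
      inter_subset_right (hS.smoothFieldOn_hliftField hO' hU) (smoothOn_pullField hV)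
    exact ContMDiffOn.comp (f := sectionMap W) h1 (hW.mono hO'O)
      fun x hx => ⟨hx, hW0 x (hO'O hx)⟩

/-- Horizontal lifts are their own horizontal parts, so either torsion condition gives
$T(U^{\mathfrak h}, V^{\mathfrak h}) = 0$, and the bracket of the lifts projects to $[U, V]$. -/
lemma IsSemispray.torsion_hliftField (hS : IsSemispray S) (h : IsVertConnection nabla)
    (hT : T2 S nabla ∨ T3 nabla) (hO : IsOpen O) (hU : SmoothFieldOn 𝓘(ℝ, E) U O)
    (hV : SmoothFieldOn 𝓘(ℝ, E) V O) (hw : w ∈ slitOver O) :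
    nabla (pullField V) w (hliftField S U w) - nabla (pullField U) w (hliftField S V w)
      = VectorField.mlieBracket 𝓘(ℝ, E) U V w.proj := by
  have hop := isOpen_slitOver (E := E) hO
  have sU := hS.smoothFieldOn_hliftField hO hU
  have sV := hS.smoothFieldOn_hliftField hO hV
  have pr : ∀ {U : Π x : M, TangentSpace 𝓘(ℝ, E) x}, ∀ z ∈ slitOver O,
      dproj z (hliftField S U z) = U z.proj := fun z hz => hS.dproj_hliftField hz.2 _
  rw [← sub_eq_zero]
  rcases hT with hT | hT
  · have hh : ∀ {U : Π x : M, TangentSpace 𝓘(ℝ, E) x}, SmoothFieldOn 𝓘(ℝ, E) U O →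
        ∀ z ∈ slitOver O, horPart S (hliftField S U) z = hliftField S U z := fun hU z hz => by
      rw [hS.horPart_eq hz.2 ((hS.smoothFieldOn_hliftField hO hU).smoothFieldAt hop hz), pr z hz,
        hliftField]
    have pr' : ∀ {U : Π x : M, TangentSpace 𝓘(ℝ, E) x}, SmoothFieldOn 𝓘(ℝ, E) U O →
        ∀ᶠ z in 𝓝 w, dproj z (horPart S (hliftField S U) z) = U z.proj := fun hU => by
      filter_upwards [hop.mem_nhds hw] with z hz
      rw [hh hU z hz, pr z hz]
    have ht := hT (slitOver O) (hliftField S U) (hliftField S V) hop inter_subset_right sU sV w hw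
    rwa [h.torsion_eq hw.2 (pr' hU) (pr' hV)
      (hS.smoothFieldAt_horPart hw.2 (sU.smoothFieldAt hop hw))
      (hS.smoothFieldAt_horPart hw.2 (sV.smoothFieldAt hop hw))
      (hU.smoothFieldAt hO hw.1) (hV.smoothFieldAt hO hw.1), hh hU w hw, hh hV w hw] at ht
  · have ht := hT (slitOver O) (hliftField S U) (hliftField S V) hop inter_subset_right sU sV w hw
    rwa [h.torsion_eq hw.2 (Filter.eventually_of_mem (hop.mem_nhds hw) pr)
      (Filter.eventually_of_mem (hop.mem_nhds hw) pr)
      (sU.smoothFieldAt hop hw) (sV.smoothFieldAt hop hw)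
      (hU.smoothFieldAt hO hw.1) (hV.smoothFieldAt hO hw.1)] at ht

lemma IsSemispray.isTorsionFreeOn (hS : IsSemispray S) (h : IsVertConnection nabla)
    (hT : T2 S nabla ∨ T3 nabla) (hO : IsOpen O) (hW0 : ∀ x ∈ O, W x ≠ 0) :
    IsTorsionFreeOn O (affineFamily S nabla W) := fun _ _ hU hV _ hx =>
  hS.torsion_hliftField h hT hO hU hV (sectionMap_mem_slitOver hx hW0)

/-- If `∇_{i_w v} W^v = 0` for all `v`, then `i_w (D_u W)` is the vertical part of `W_* u`. -/
lemma IsSemispray.sectionDeriv_eq (hS : IsSemispray S) (h : IsLift S nabla)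
    (hW : SmoothFieldAt 𝓘(ℝ, E) W x) (hx : W x ≠ 0)
    (hv : ∀ v, nabla (pullField W) ⟨x, W x⟩ (vlift ⟨x, W x⟩ v) = 0)
    (u : TangentSpace 𝓘(ℝ, E) x) :
    sectionDeriv W x u
      = hlift S ⟨x, W x⟩ u + vlift ⟨x, W x⟩ (affineFamily S nabla W W x u) := by
  set w : TangentBundle 𝓘(ℝ, E) M := ⟨x, W x⟩ with hw
  have hp : dproj w (sectionDeriv W x u - hlift S w u) = 0 := by
    rw [map_sub, dproj_sectionDeriv hW, hS.dproj_hlift hx, sub_self]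
  obtain ⟨v, hv'⟩ := exists_eq_vlift hp
  obtain ⟨X, hX, hXw⟩ := exists_smoothFieldOn_extension (I := 𝓘(ℝ, E).tangent) w
    (sectionDeriv W x u)
  have hU := (chartAt (ModelProd E E) w).open_source
  have hwU := mem_chart_source (ModelProd E E) w
  -- The lift condition evaluates $\nabla_{W_*u}C$ to $v$, where $i_w(v)$ is the vertical part of
  -- $W_*u$; then $C$ is replaced by $W^{\mathfrak v}$.
  have h1 := h.nabla_canon _ X (hU.inter isOpen_slit) inter_subset_right
    (hX.mono inter_subset_left) w ⟨hwU, hx⟩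
  rw [hS.verPart_eq hx (hX.smoothFieldAt hU hwU), hXw, dproj_sectionDeriv hW, hv',
    ← h.connection.pullField_sectionDeriv hW hx] at h1
  have h2 : sectionDeriv W x u = hlift S w u + vlift w v := by rw [← hv', add_sub_cancel]
  rw [h2] at h1
  have h3 := vlift_injective w h1
  rw [map_add, hv v, add_zero] at h3
  rw [h2, ← h3]
  rfl

end AffineFamily

/-! ### Iterated directional derivatives and Euler's relations -/

section SecondDerivatives

variable {G : Type*} [NormedAddCommGroup G] [NormedSpace ℝ G] {f : G → ℝ} {w : G}

lemma hasDerivAt_comp_line {G' : Type*} [NormedAddCommGroup G'] [NormedSpace ℝ G'] {g : G → G'}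
    (hg : DifferentiableAt ℝ g w) (u : G) :
    HasDerivAt (fun t : ℝ => g (w + t • u)) (fderiv ℝ g w u) 0 := by
  have h1 : HasDerivAt (fun t : ℝ => w + t • u) u 0 := by
    simpa using ((hasDerivAt_id (0 : ℝ)).smul_const u).const_add w
  have h2 : HasFDerivAt g (fderiv ℝ g w) (w + (0 : ℝ) • u) := by
    rw [zero_smul, add_zero]
    exact hg.hasFDerivAt
  exact h2.comp_hasDerivAt (0 : ℝ) h1

lemma hasDerivAt_clm_comp_line {A B : Type*} [NormedAddCommGroup A] [NormedSpace ℝ A]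
    [NormedAddCommGroup B] [NormedSpace ℝ B] {g : G → A →L[ℝ] B}
    (hg : DifferentiableAt ℝ g w) (u : G) :
    HasDerivAt (fun t : ℝ => g (w + t • u)) (fderiv ℝ g w u) 0 :=
  hasDerivAt_comp_line hg u

lemma eventually_line {p : G → Prop} (h : ∀ᶠ y in 𝓝 w, p y) (u : G) :
    ∀ᶠ t : ℝ in 𝓝 0, p (w + t • u) := by
  have hc : Filter.Tendsto (fun t : ℝ => w + t • u) (𝓝 0) (𝓝 w) := by
    have : Continuous (fun t : ℝ => w + t • u) := by fun_prop
    simpa using this.tendsto 0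
  exact hc.eventually h

lemma deriv_deriv_line (hf : ContDiffAt ℝ 4 f w) (u v : G) :
    deriv (fun t : ℝ => deriv (fun s : ℝ => f (w + s • u + t • v)) 0) 0
      = fderiv ℝ (fderiv ℝ f) w v u := by
  have h1 : (fun t : ℝ => deriv (fun s : ℝ => f (w + s • u + t • v)) 0)
      =ᶠ[𝓝 0] fun t => fderiv ℝ f (w + t • v) u := by
    filter_upwards [eventually_line (hf.eventually (by simp)) v] with t ht
    rw [← (hasDerivAt_comp_line (ht.differentiableAt (by simp)) u).deriv]
    congr 1
    funext s
    rw [add_right_comm]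
  rw [h1.deriv_eq]
  have h2 : DifferentiableAt ℝ (fderiv ℝ f) w :=
    (hf.fderiv_right (m := 3) (by norm_num)).differentiableAt (by simp)
  exact ((hasDerivAt_comp_line h2 v).clm_apply (hasDerivAt_const (0 : ℝ) u)).deriv.trans (by simp)

lemma fderiv_fderiv_symm (hf : ContDiffAt ℝ 4 f w) (u v : G) :
    fderiv ℝ (fderiv ℝ f) w u v = fderiv ℝ (fderiv ℝ f) w v u :=
  (hf.isSymmSndFDerivAt (by simp; norm_num)) u v

lemma differentiableAt_fderiv_fderiv (hf : ContDiffAt ℝ 4 f w) :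
    DifferentiableAt ℝ (fderiv ℝ (fderiv ℝ f)) w :=
  ((hf.fderiv_right (m := 3) (by norm_num)).fderiv_right (m := 2) (by norm_num)).differentiableAt
    (by simp)

lemma hasDerivAt_fderiv_fderiv_line (hf : ContDiffAt ℝ 4 f w) (u v z : G) :
    HasDerivAt (fun r : ℝ => fderiv ℝ (fderiv ℝ f) (w + r • u) v z)
      (fderiv ℝ (fderiv ℝ (fderiv ℝ f)) w u v z) 0 := by
  have h1 := hasDerivAt_clm_comp_line (differentiableAt_fderiv_fderiv hf) u
  simpa using (h1.clm_apply (hasDerivAt_const (0 : ℝ) v)).clm_apply (hasDerivAt_const (0 : ℝ) z)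

lemma deriv_deriv_deriv_line (hf : ContDiffAt ℝ 4 f w) (u v z : G) :
    deriv (fun r : ℝ => deriv (fun s : ℝ => deriv (fun t : ℝ =>
      f (w + r • u + s • v + t • z)) 0) 0) 0 = fderiv ℝ (fderiv ℝ (fderiv ℝ f)) w u v z := by
  rw [← (hasDerivAt_fderiv_fderiv_line hf u v z).deriv]
  refine Filter.EventuallyEq.deriv_eq ?_
  filter_upwards [eventually_line (hf.eventually (by simp)) u] with r hr
  rw [← deriv_deriv_line hr]
  congr 1
  funext s
  congr 1
  funext t
  rw [add_right_comm]

lemma fderiv_fderiv_fderiv_symm (hf : ContDiffAt ℝ 4 f w) (u v z : G) :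
    fderiv ℝ (fderiv ℝ (fderiv ℝ f)) w u v z = fderiv ℝ (fderiv ℝ (fderiv ℝ f)) w u z v := by
  rw [← (hasDerivAt_fderiv_fderiv_line hf u v z).deriv,
    ← (hasDerivAt_fderiv_fderiv_line hf u z v).deriv]
  refine Filter.EventuallyEq.deriv_eq ?_
  filter_upwards [eventually_line (hf.eventually (by simp)) u] with r hr
  exact fderiv_fderiv_symm hr v z

/-- Euler's relation for a function that is positively homogeneous of degree two. -/
lemma fderiv_fderiv_self (hf : ContDiffAt ℝ 4 f w)
    (hhom : ∀ (y : G) (c : ℝ), 0 < c → f (c • y) = c ^ 2 * f y) :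
    fderiv ℝ (fderiv ℝ f) w w = fderiv ℝ f w := by
  have h1 : ∀ᶠ t : ℝ in 𝓝 0, fderiv ℝ f (w + t • w) = (1 + t) • fderiv ℝ f w := by
    -- Homogeneity is available for positive factors only, here for $1 + t$.
    have hpos : ∀ᶠ t : ℝ in 𝓝 0, -1 < t := lt_mem_nhds (by norm_num)
    filter_upwards [eventually_line (hf.eventually (by simp)) w, hpos] with t ht htp
    have hc : 0 < 1 + t := by linarith
    have hw : w + t • w = (1 + t) • w := by rw [add_smul, one_smul]
    rw [hw] at ht ⊢
    have h2 := (ht.differentiableAt (by simp)).hasFDerivAt.comp w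
      ((hasFDerivAt_id (𝕜 := ℝ) w).const_smul (1 + t))
    have h3 := (hf.differentiableAt (by simp)).hasFDerivAt.const_mul ((1 + t) ^ 2)
    have h4 : (f ∘ fun y : G => (1 + t) • y) = fun y => (1 + t) ^ 2 * f y :=
      funext fun y => hhom y _ hc
    have h2 := h4 ▸ h2
    ext v
    have h5 := DFunLike.congr_fun (h2.unique h3) v
    simp only [ContinuousLinearMap.comp_apply, smul_apply,
      ContinuousLinearMap.id_apply, map_smul, smul_eq_mul] at h5 ⊢
    have h6 : (1 + t) * (fderiv ℝ f ((1 + t) • w) v) = (1 + t) * ((1 + t) * fderiv ℝ f w v) := by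
      rw [h5]; ring
    exact mul_left_cancel₀ hc.ne' h6
  have h2 : DifferentiableAt ℝ (fderiv ℝ f) w :=
    (hf.fderiv_right (m := 3) (by norm_num)).differentiableAt (by simp)
  have h3 := hasDerivAt_comp_line h2 w
  have h4 : HasDerivAt (fun t : ℝ => (1 + t) • fderiv ℝ f w) (fderiv ℝ f w) 0 := by
    simpa using ((hasDerivAt_id (0 : ℝ)).const_add 1).smul_const (fderiv ℝ f w)
  exact h3.unique (h4.congr_of_eventuallyEq h1)

/-- Differentiating Euler's relation $D^2f(y)(y, z) = Df(y)z$ at $y = w$ along $u$ gives $D^3f(u, w,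
z) + D^2f(u, z) = D^2f(u, z)$. -/
lemma fderiv_fderiv_fderiv_self (hf : ContDiffAt ℝ 4 f w)
    (hhom : ∀ (y : G) (c : ℝ), 0 < c → f (c • y) = c ^ 2 * f y) (u z : G) :
    fderiv ℝ (fderiv ℝ (fderiv ℝ f)) w u w z = 0 := by
  have h2 : DifferentiableAt ℝ (fderiv ℝ f) w :=
    (hf.fderiv_right (m := 3) (by norm_num)).differentiableAt (by simp)
  have h1 := hasDerivAt_clm_comp_line (differentiableAt_fderiv_fderiv hf) u
  have hl : HasDerivAt (fun t : ℝ => w + t • u) u 0 := by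
    simpa using ((hasDerivAt_id (0 : ℝ)).smul_const u).const_add w
  have h3 := (h1.clm_apply hl).clm_apply (hasDerivAt_const (0 : ℝ) z)
  have h4 := (hasDerivAt_comp_line h2 u).clm_apply (hasDerivAt_const (0 : ℝ) z)
  have h5 : (fun t : ℝ => fderiv ℝ (fderiv ℝ f) (w + t • u) (w + t • u) z)
      =ᶠ[𝓝 0] fun t => fderiv ℝ f (w + t • u) z := by
    filter_upwards [eventually_line (hf.eventually (by simp)) u] with t ht
    rw [fderiv_fderiv_self ht hhom]
  have h6 := h3.unique (h4.congr_of_eventuallyEq h5)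
  simpa using h6

end SecondDerivatives

/-! ### The fundamental tensor and the Cartan tensor -/

section FundamentalTensor

variable {E : Type*} [NormedAddCommGroup E] [NormedSpace ℝ E]
  {M : Type*} [TopologicalSpace M] [ChartedSpace E M] [IsManifold 𝓘(ℝ, E) ∞ M]
  {F : TangentBundle 𝓘(ℝ, E) M → ℝ} {w w₀ z : TangentBundle 𝓘(ℝ, E) M}
  {T V : Π x : M, TangentSpace 𝓘(ℝ, E) x}

/-- The function `F²` on the tangent space at `x`, in the coordinates of the chart at `x`. -/
def fiberSq (F : TangentBundle 𝓘(ℝ, E) M → ℝ) (x : M) (y : E) : ℝ :=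
  F ⟨x, chartDerivSymm 𝓘(ℝ, E) x x y⟩ ^ 2

lemma fiberSq_chartDeriv (x : M) (u : TangentSpace 𝓘(ℝ, E) x) :
    fiberSq F x (chartDeriv 𝓘(ℝ, E) x x u) = F ⟨x, u⟩ ^ 2 := by
  rw [fiberSq, chartDerivSymm_chartDeriv (mem_chart_source E x)]

lemma IsFinslerMetric.contMDiffAt_sq (hF : IsFinslerMetric F) (hw : w ∈ slit E M) :
    ContMDiffAt 𝓘(ℝ, E).tangent 𝓘(ℝ, ℝ) ∞ (fun z => F z ^ 2) w :=
  (hF.smooth.contMDiffAt (isOpen_slit.mem_nhds hw)).pow 2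

lemma chartDeriv_ne_zero (hw : w ∈ slit E M) : chartDeriv 𝓘(ℝ, E) w.proj w.proj w.2 ≠ 0 :=
  fun h => hw (chartDeriv_injective (mem_chart_source E w.proj) (h.trans (map_zero _).symm))

lemma IsFinslerMetric.contDiffAt_fiberSq (hF : IsFinslerMetric F) (x : M) {y : E} (hy : y ≠ 0) :
    ContDiffAt ℝ 4 (fiberSq F x) y := by
  have hx := mem_chart_source E x
  have hsl : (⟨x, chartDerivSymm 𝓘(ℝ, E) x x y⟩ : TangentBundle 𝓘(ℝ, E) M) ∈ slit E M := by
    intro h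
    apply hy
    rw [← chartDeriv_chartDerivSymm (I := 𝓘(ℝ, E)) hx y]
    exact (congrArg _ h).trans (map_zero _)
  have h1 : ContMDiffAt 𝓘(ℝ, E) 𝓘(ℝ, E).tangent ∞
      (fun y : E => (⟨x, chartDerivSymm 𝓘(ℝ, E) x x y⟩ : TangentBundle 𝓘(ℝ, E) M)) y := by
    rw [contMDiffAt_tangent_iff (x₀ := x) hx]
    refine ⟨contMDiffAt_const, ?_⟩
    simp only [chartDeriv_chartDerivSymm hx]
    exact contMDiffAt_id
  have h2 := ((hF.contMDiffAt_sq hsl).comp y h1).contDiffAt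
  exact_mod_cast contDiffAt_infty.1 h2 4

lemma IsFinslerMetric.contDiffAt_fiberSq_slit (hF : IsFinslerMetric F) (hw : w ∈ slit E M) :
    ContDiffAt ℝ 4 (fiberSq F w.proj) (chartDeriv 𝓘(ℝ, E) w.proj w.proj w.2) :=
  hF.contDiffAt_fiberSq _ (chartDeriv_ne_zero hw)

lemma IsFinslerMetric.fiberSq_smul (hF : IsFinslerMetric F) (x : M) (y : E) (c : ℝ) (hc : 0 < c) :
    fiberSq F x (c • y) = c ^ 2 * fiberSq F x y := by
  rw [fiberSq, fiberSq, map_smul, ← mul_pow]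
  exact congrArg (· ^ 2) (hF.homogeneous ⟨x, chartDerivSymm 𝓘(ℝ, E) x x y⟩ c hc)

/-- Reading the fibre in the chart at its own foot point makes $g_w$ a Hessian on a normed space,
from which symmetry and linearity are immediate. -/
lemma IsFinslerMetric.fundTensor_eq (hF : IsFinslerMetric F) (hw : w ∈ slit E M)
    (u v : TangentSpace 𝓘(ℝ, E) w.proj) :
    fundTensor F w u v = 1 / 2 * fderiv ℝ (fderiv ℝ (fiberSq F w.proj))
      (chartDeriv 𝓘(ℝ, E) w.proj w.proj w.2) (chartDeriv 𝓘(ℝ, E) w.proj w.proj u)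
      (chartDeriv 𝓘(ℝ, E) w.proj w.proj v) := by
  have h := hF.contDiffAt_fiberSq_slit hw
  rw [fderiv_fderiv_symm h, ← deriv_deriv_line h, fundTensor]
  simp only [← map_smul, ← map_add, fiberSq_chartDeriv]

lemma IsFinslerMetric.cartanTensor_eq (hF : IsFinslerMetric F) (hw : w ∈ slit E M)
    (u v z : TangentSpace 𝓘(ℝ, E) w.proj) :
    cartanTensor F w u v z = 1 / 4 * fderiv ℝ (fderiv ℝ (fderiv ℝ (fiberSq F w.proj)))
      (chartDeriv 𝓘(ℝ, E) w.proj w.proj w.2) (chartDeriv 𝓘(ℝ, E) w.proj w.proj u)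
      (chartDeriv 𝓘(ℝ, E) w.proj w.proj v) (chartDeriv 𝓘(ℝ, E) w.proj w.proj z) := by
  rw [← deriv_deriv_deriv_line (hF.contDiffAt_fiberSq_slit hw), cartanTensor]
  simp only [← map_smul, ← map_add, fiberSq_chartDeriv]

lemma IsFinslerMetric.fundTensor_comm (hF : IsFinslerMetric F) (hw : w ∈ slit E M)
    (u v : TangentSpace 𝓘(ℝ, E) w.proj) : fundTensor F w u v = fundTensor F w v u := by
  rw [hF.fundTensor_eq hw, hF.fundTensor_eq hw,
    fderiv_fderiv_symm (hF.contDiffAt_fiberSq_slit hw)]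

lemma IsFinslerMetric.fundTensor_sub_left (hF : IsFinslerMetric F) (hw : w ∈ slit E M)
    (u u' v : TangentSpace 𝓘(ℝ, E) w.proj) :
    fundTensor F w (u - u') v = fundTensor F w u v - fundTensor F w u' v := by
  simp only [hF.fundTensor_eq hw, map_sub, sub_apply, mul_sub]

lemma IsFinslerMetric.fundTensor_zero_left (hF : IsFinslerMetric F) (hw : w ∈ slit E M)
    (v : TangentSpace 𝓘(ℝ, E) w.proj) : fundTensor F w 0 v = 0 := by
  simp only [hF.fundTensor_eq hw, map_zero, zero_apply, mul_zero]

lemma IsFinslerMetric.fundTensor_zero_right (hF : IsFinslerMetric F) (hw : w ∈ slit E M)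
    (v : TangentSpace 𝓘(ℝ, E) w.proj) : fundTensor F w v 0 = 0 := by
  simp only [hF.fundTensor_eq hw, map_zero, mul_zero]

lemma IsFinslerMetric.eq_zero_of_fundTensor_self (hF : IsFinslerMetric F) (hw : w ∈ slit E M)
    {u : TangentSpace 𝓘(ℝ, E) w.proj} (h : fundTensor F w u u = 0) : u = 0 :=
  by_contra fun hu => (hF.posDef w hw u hu).ne' h

lemma IsFinslerMetric.cartanTensor_sub_left (hF : IsFinslerMetric F) (hw : w ∈ slit E M)
    (u u' v z : TangentSpace 𝓘(ℝ, E) w.proj) :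
    cartanTensor F w (u - u') v z = cartanTensor F w u v z - cartanTensor F w u' v z := by
  simp only [hF.cartanTensor_eq hw]
  rw [(chartDeriv 𝓘(ℝ, E) w.proj w.proj).map_sub, ContinuousLinearMap.map_sub, sub_apply,
    sub_apply, mul_sub]

lemma IsFinslerMetric.cartanTensor_zero_left (hF : IsFinslerMetric F) (hw : w ∈ slit E M)
    (v z : TangentSpace 𝓘(ℝ, E) w.proj) : cartanTensor F w 0 v z = 0 := by
  rw [hF.cartanTensor_eq hw, (chartDeriv 𝓘(ℝ, E) w.proj w.proj).map_zero,
    ContinuousLinearMap.map_zero, zero_apply, zero_apply, mul_zero]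

lemma IsFinslerMetric.cartanTensor_comm_right (hF : IsFinslerMetric F) (hw : w ∈ slit E M)
    (u v z : TangentSpace 𝓘(ℝ, E) w.proj) : cartanTensor F w u v z = cartanTensor F w u z v := by
  rw [hF.cartanTensor_eq hw, hF.cartanTensor_eq hw,
    fderiv_fderiv_fderiv_symm (hF.contDiffAt_fiberSq_slit hw)]

lemma IsFinslerMetric.cartanTensor_base_middle (hF : IsFinslerMetric F) (hw : w ∈ slit E M)
    (u z : TangentSpace 𝓘(ℝ, E) w.proj) : cartanTensor F w u w.2 z = 0 := by
  rw [hF.cartanTensor_eq hw, fderiv_fderiv_fderiv_self (hF.contDiffAt_fiberSq_slit hw)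
    (hF.fiberSq_smul w.proj), mul_zero]

lemma IsFinslerMetric.cartanTensor_base_right (hF : IsFinslerMetric F) (hw : w ∈ slit E M)
    (u v : TangentSpace 𝓘(ℝ, E) w.proj) : cartanTensor F w u v w.2 = 0 := by
  rw [hF.cartanTensor_comm_right hw, hF.cartanTensor_base_middle hw]

/-- The normalizations $\tfrac12$ of $g$ and $\tfrac14$ of $\mathrm C$ produce the factor $2$. This
is where the Cartan term of the theorem originates. -/
lemma IsFinslerMetric.hasDerivAt_fundTensor_line (hF : IsFinslerMetric F) (hw : w ∈ slit E M)
    (u v z : TangentSpace 𝓘(ℝ, E) w.proj) :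
    HasDerivAt (fun t : ℝ => fundTensor F ⟨w.proj, w.2 + t • u⟩ v z)
      (2 * cartanTensor F w u v z) 0 := by
  have h1 := (hasDerivAt_fderiv_fderiv_line (hF.contDiffAt_fiberSq_slit hw)
    (chartDeriv 𝓘(ℝ, E) w.proj w.proj u) (chartDeriv 𝓘(ℝ, E) w.proj w.proj v)
    (chartDeriv 𝓘(ℝ, E) w.proj w.proj z)).const_mul (1 / 2 : ℝ)
  have h2 : 2 * cartanTensor F w u v z = 1 / 2 * fderiv ℝ (fderiv ℝ (fderiv ℝ (fiberSq F w.proj)))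
      (chartDeriv 𝓘(ℝ, E) w.proj w.proj w.2) (chartDeriv 𝓘(ℝ, E) w.proj w.proj u)
      (chartDeriv 𝓘(ℝ, E) w.proj w.proj v) (chartDeriv 𝓘(ℝ, E) w.proj w.proj z) := by
    rw [hF.cartanTensor_eq hw]
    ring
  rw [h2]
  refine h1.congr_of_eventuallyEq ?_
  -- The Hessian formula for $g$ needs $w + tu \ne 0$, which holds for small $t$.
  filter_upwards [eventually_line (isOpen_ne.mem_nhds (chartDeriv_ne_zero hw))
    (chartDeriv 𝓘(ℝ, E) w.proj w.proj u)] with t ht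
  have hsl : (⟨w.proj, w.2 + t • u⟩ : TangentBundle 𝓘(ℝ, E) M) ∈ slit E M := by
    intro h0
    apply ht
    rw [← map_smul, ← map_add]
    exact (congrArg _ h0).trans (map_zero _)
  rw [hF.fundTensor_eq hsl, map_add, map_smul]

lemma mvfderiv_vlift {f : TangentBundle 𝓘(ℝ, E) M → ℝ}
    (hf : MDifferentiableAt 𝓘(ℝ, E).tangent 𝓘(ℝ, ℝ) f w) (u : TangentSpace 𝓘(ℝ, E) w.proj)
    {a : ℝ} (ha : HasDerivAt (fun t : ℝ => f ⟨w.proj, w.2 + t • u⟩) a 0) :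
    mvfderiv 𝓘(ℝ, E).tangent f w (vlift w u) = a := by
  set c : ℝ → TangentBundle 𝓘(ℝ, E) M := fun t => ⟨w.proj, w.2 + t • u⟩ with hc
  have hc0 : c 0 = w := by simp [hc]
  have key : ∀ (y : TangentBundle 𝓘(ℝ, E) M) (hy : y = w) (η : E × E),
      mfderiv 𝓘(ℝ, E).tangent 𝓘(ℝ, ℝ) f w η = mfderiv 𝓘(ℝ, E).tangent 𝓘(ℝ, ℝ) f y η := by
    rintro y rfl η
    rfl
  have h1 : HasMFDerivAt 𝓘(ℝ, E).tangent 𝓘(ℝ, ℝ) f (c 0)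
      (mfderiv 𝓘(ℝ, E).tangent 𝓘(ℝ, ℝ) f (c 0)) := by
    rw [← hc0] at hf
    exact hf.hasMFDerivAt
  have h2 := h1.comp (0 : ℝ) (mdifferentiableAt_fiberLine u 0).hasMFDerivAt
  have h3 := DFunLike.congr_fun (hasMFDerivAt_unique h2 ha.hasFDerivAt.hasMFDerivAt) (1 : ℝ)
  refine (key (c 0) hc0 _).trans (Eq.trans h3 ?_)
  exact one_smul ℝ a

/-- In `fundTensor_eq` the chart moves with the foot point, so it says nothing about regularity
across fibres. A fixed natural chart $\varphi$ of $TM$ is used instead: there $g_z(T, V)$ is half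
the Hessian of $F^2$ at $\varphi(z)$ on the vertical vectors $(0, V)$ and $(0, T)$. -/
lemma IsFinslerMetric.mdifferentiableAt_fundTensor (hF : IsFinslerMetric F) (hw : w ∈ slit E M)
    (hT : SmoothFieldAt 𝓘(ℝ, E) T w.proj) (hV : SmoothFieldAt 𝓘(ℝ, E) V w.proj) :
    MDifferentiableAt 𝓘(ℝ, E).tangent 𝓘(ℝ, ℝ)
      (fun z => fundTensor F z (T z.proj) (V z.proj)) w := by
  have hx := mem_chart_source E w.proj
  have hwc := mem_chart_source (ModelProd E E) w
  set φ := extChartAt 𝓘(ℝ, E).tangent w with hφ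
  set f : E × E → ℝ := fun q => F (φ.symm q) ^ 2 with hf
  have hfw : ContDiffAt ℝ 4 f (φ w) := by
    have h1 : ContMDiffAt 𝓘(ℝ, E × E) 𝓘(ℝ, E).tangent ∞ φ.symm (φ w) := by
      have := contMDiffWithinAt_extChartAt_symm_range (I := 𝓘(ℝ, E).tangent) (n := ∞) w
        (mem_extChartAt_target w)
      rwa [ModelWithCorners.range_eq_univ, contMDiffWithinAt_univ] at this
    have h2 := hF.contMDiffAt_sq hw
    rw [← extChartAt_to_inv (I := 𝓘(ℝ, E).tangent) w] at h2
    have h3 := (h2.comp (φ w) h1).contDiffAt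
    exact_mod_cast contDiffAt_infty.1 h3 4
  have hφc : ContMDiffAt 𝓘(ℝ, E).tangent 𝓘(ℝ, E × E) ∞ φ w := contMDiffAt_extChartAt
  set A : (Π x : M, TangentSpace 𝓘(ℝ, E) x) → TangentBundle 𝓘(ℝ, E) M → E × E :=
    fun T z => ContinuousLinearMap.inr ℝ E E (chartDeriv 𝓘(ℝ, E) w.proj z.proj (T z.proj)) with hA
  have hAd : ∀ {T : Π x : M, TangentSpace 𝓘(ℝ, E) x}, SmoothFieldAt 𝓘(ℝ, E) T w.proj →
      MDifferentiableAt 𝓘(ℝ, E).tangent 𝓘(ℝ, E × E) (A T) w := fun hT =>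
    ((ContinuousLinearMap.inr ℝ E E).contMDiff.contMDiffAt.comp w
      (((smoothFieldAt_iff hx).1 hT).comp w contMDiffAt_proj_tangent)).mdifferentiableAt (by simp)
  have hD : MDifferentiableAt 𝓘(ℝ, E).tangent 𝓘(ℝ, E × E →L[ℝ] E × E →L[ℝ] ℝ)
      (fun z => fderiv ℝ (fderiv ℝ f) (φ z)) w :=
    (differentiableAt_fderiv_fderiv hfw).mdifferentiableAt.comp w
      (hφc.mdifferentiableAt (by simp))
  have hG : MDifferentiableAt 𝓘(ℝ, E).tangent 𝓘(ℝ, ℝ)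
      (fun z => (1 / 2 : ℝ) * fderiv ℝ (fderiv ℝ f) (φ z) (A V z) (A T z)) w :=
    mdifferentiableAt_const.mul ((hD.clm_apply (hAd hV)).clm_apply (hAd hT))
  refine hG.congr_of_eventuallyEq ?_
  filter_upwards [(chartAt (ModelProd E E) w).open_source.mem_nhds hwc,
    hφc.continuousAt.eventually (hfw.eventually (by simp))] with z hz hfz
  have hzc := mem_chart_tangent_source.1 hz
  rw [← deriv_deriv_line hfz, fundTensor]
  congr 1
  congr 1
  funext t
  congr 1
  funext s
  -- Natural charts are linear on fibres, so they carry affine combinations in a fibre to affine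
  -- combinations in $E \times E$.
  have h1 : φ z + s • A T z + t • A V z
      = φ ⟨z.proj, z.2 + s • T z.proj + t • V z.proj⟩ := by
    refine Prod.ext ?_ ?_
    · simp [hA, hφ]
    · refine Eq.trans ?_ (extChartAt_tangent_snd (w₀ := w)
        (z := ⟨z.proj, z.2 + s • T z.proj + t • V z.proj⟩) hzc).symm
      refine Eq.trans ?_ (b := chartDeriv 𝓘(ℝ, E) w.proj z.proj
        (z.2 + s • T z.proj + t • V z.proj)) rfl
      rw [map_add, map_add, map_smul, map_smul, ← extChartAt_tangent_snd hzc]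
      rfl
  rw [h1]
  simp only [hf]
  rw [φ.left_inv]
  simpa [hφ] using mem_chart_tangent_source.2 hzc

end FundamentalTensor

/-! ### Vertical derivatives of $W^{\mathfrak v}$, the derivative of $g_W$, and uniqueness -/

section MetricProperties

variable {E : Type*} [NormedAddCommGroup E] [NormedSpace ℝ E] [FiniteDimensional ℝ E]
  {M : Type*} [TopologicalSpace M] [ChartedSpace E M] [IsManifold 𝓘(ℝ, E) ∞ M]
  {F : TangentBundle 𝓘(ℝ, E) M → ℝ} {w : TangentBundle 𝓘(ℝ, E) M} {S : FieldTM E M}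
  {nabla : VertOperator E M} {O : Set M} {U T V W : Π x : M, TangentSpace 𝓘(ℝ, E) x} {x : M}

/-- Every vertical vector is a value of `J(X)` for a smooth local vector field `X`. -/
lemma IsSemispray.exists_almostTangent_eq_vlift (hS : IsSemispray S) (hw : w ∈ slit E M)
    (v : TangentSpace 𝓘(ℝ, E) w.proj) :
    ∃ X : FieldTM E M, SmoothFieldOn 𝓘(ℝ, E).tangent X (chartAt (ModelProd E E) w).source ∧
      almostTangent X w = vlift w v := by
  obtain ⟨X, hX, hXw⟩ := exists_smoothFieldOn_extension (I := 𝓘(ℝ, E).tangent) w (hlift S w v)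
  exact ⟨X, hX, by rw [almostTangent, hXw, hS.dproj_hlift hw]⟩

lemma IsSemispray.eventually_dproj_hliftField (hS : IsSemispray S) (hw : w ∈ slit E M)
    (U : Π x : M, TangentSpace 𝓘(ℝ, E) x) :
    ∀ᶠ z in 𝓝 w, dproj z (hliftField S U z) = U z.proj := by
  filter_upwards [isOpen_slit.mem_nhds hw] with z hz
  exact hS.dproj_hliftField hz U

lemma SmoothFieldOn.almostTangent {X : FieldTM E M} {Ω : Set (TangentBundle 𝓘(ℝ, E) M)}
    (hX : SmoothFieldOn 𝓘(ℝ, E).tangent X Ω) (hΩ : IsOpen Ω) :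
    SmoothFieldOn 𝓘(ℝ, E).tangent (almostTangent X) Ω :=
  smoothFieldOn_of_forall fun _ hz => (hX.smoothFieldAt hΩ hz).almostTangent

/-- If the torsion vanishes, then vertical derivatives of vertical lifts vanish. -/
lemma IsSemispray.nabla_vlift_of_T3 (hS : IsSemispray S) (h : IsVertConnection nabla)
    (hT : T3 nabla) (hO : IsOpen O) (hV : SmoothFieldOn 𝓘(ℝ, E) V O) (hw : w ∈ slitOver O)
    (v : TangentSpace 𝓘(ℝ, E) w.proj) : nabla (pullField V) w (vlift w v) = 0 := by
  obtain ⟨X, hX, hXw⟩ := hS.exists_almostTangent_eq_vlift hw.2 v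
  have hc := (chartAt (ModelProd E E) w).open_source
  have hΩ := hc.inter (isOpen_slitOver (E := E) hO)
  have hwΩ : w ∈ (chartAt (ModelProd E E) w).source ∩ slitOver O :=
    ⟨mem_chart_source (ModelProd E E) w, hw⟩
  have hX' := hX.mono (inter_subset_left (t := slitOver O))
  have hVl := hS.smoothFieldOn_hliftField hO hV
  have ht := hT _ (almostTangent X) (hliftField S V) hΩ (fun z hz => hz.2.2)
    (SmoothFieldOn.almostTangent hX' hΩ) (hVl.mono inter_subset_right) w hwΩ
  rwa [h.torsion_almostTangent hw.2 (hS.eventually_dproj_hliftField hw.2 V)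
    (hX.smoothFieldAt hc hwΩ.1) (hVl.smoothFieldAt (isOpen_slitOver hO) hw)
    (hV.smoothFieldAt hO hw.1), hXw] at ht

/-- If `∇ g` vanishes in vertical directions and the torsion is symmetric, then the vertical
derivatives of `W^v` vanish along `W`. -/
lemma IsSemispray.nabla_vlift_of_M7 (hF : IsFinslerMetric F) (hS : IsSemispray S)
    (h : IsVertConnection nabla) (hM : M7 F nabla)
    (hvert : ∀ (Ω : Set (TangentBundle 𝓘(ℝ, E) M)) (X : FieldTM E M) (Y Z : VertSection E M),
      IsOpen Ω → Ω ⊆ slit E M → SmoothFieldOn 𝓘(ℝ, E).tangent X Ω → Y.SmoothOn Ω → Z.SmoothOn Ω →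
      ∀ w ∈ Ω, nablaFund F nabla (almostTangent X) Y Z w = 0)
    (hO : IsOpen O) (hW : SmoothFieldOn 𝓘(ℝ, E) W O) (hW0 : ∀ x ∈ O, W x ≠ 0) (hx : x ∈ O)
    (v : TangentSpace 𝓘(ℝ, E) x) : nabla (pullField W) ⟨x, W x⟩ (vlift ⟨x, W x⟩ v) = 0 := by
  set w : TangentBundle 𝓘(ℝ, E) M := ⟨x, W x⟩ with hwdef
  have hw : w ∈ slit E M := hW0 x hx
  -- $Z$ extends the very vector that is to vanish, so that $g(\nabla_{i_wv}W^{\mathfrak v}, Z) = 0$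
  -- suffices by positive definiteness.
  obtain ⟨Z, hZ, hZx⟩ := exists_smoothFieldOn_extension (I := 𝓘(ℝ, E)) x
    (nabla (pullField W) w (vlift w v))
  obtain ⟨X, hX, hXw⟩ := hS.exists_almostTangent_eq_vlift hw v
  have hc := (chartAt (ModelProd E E) w).open_source
  have hO' : IsOpen (O ∩ (chartAt E x).source) := hO.inter (chartAt E x).open_source
  have hso := isOpen_slitOver (E := E) hO'
  have hΩ := hc.inter hso
  have hws : w ∈ slitOver (O ∩ (chartAt E x).source) := ⟨⟨hx, mem_chart_source E x⟩, hw⟩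
  have hwΩ : w ∈ (chartAt (ModelProd E E) w).source ∩ slitOver (O ∩ (chartAt E x).source) :=
    ⟨mem_chart_source (ModelProd E E) w, hws⟩
  have hsub : (chartAt (ModelProd E E) w).source ∩ slitOver (O ∩ (chartAt E x).source)
      ⊆ slit E M := fun z hz => hz.2.2
  have hX' := hX.mono (inter_subset_left (t := slitOver (O ∩ (chartAt E x).source)))
  have hW' : SmoothFieldOn 𝓘(ℝ, E) W (O ∩ (chartAt E x).source) := hW.mono inter_subset_left
  have hZ' : SmoothFieldOn 𝓘(ℝ, E) Z (O ∩ (chartAt E x).source) := hZ.mono inter_subset_right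
  have hWl := hS.smoothFieldOn_hliftField hO' hW'
  have hZl := hS.smoothFieldOn_hliftField hO' hZ'
  have hWx := hW'.smoothFieldAt hO' hws.1
  have hZx' := hZ'.smoothFieldAt hO' hws.1
  have hXs := hX.smoothFieldAt hc hwΩ.1
  have h1 := hM _ X (hliftField S W) (hliftField S Z) hΩ hsub hX'
    (hWl.mono inter_subset_right) (hZl.mono inter_subset_right) w hwΩ
  rw [h.torsion_almostTangent hw (hS.eventually_dproj_hliftField hw W) hXs
      (hWl.smoothFieldAt hso hws) hWx,
    h.torsion_almostTangent hw (hS.eventually_dproj_hliftField hw Z) hXs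
      (hZl.smoothFieldAt hso hws) hZx', hXw, hS.dproj_hliftField hw, hS.dproj_hliftField hw] at h1
  have h2 := hvert _ X (pullField W) (pullField Z) hΩ hsub hX'
    ((smoothOn_pullField hW').mono inter_subset_right)
    ((smoothOn_pullField hZ').mono inter_subset_right) w hwΩ
  -- The derivative of $g(W^{\mathfrak v}, Z^{\mathfrak v})$ along $i_w(v)$ is $2\mathrm C_w(v, w,
  -- Z)$, zero by homogeneity.
  have h3 : dirDeriv 𝓘(ℝ, E).tangent
      (fun z => fundTensor F z (pullField W z) (pullField Z z)) w (vlift w v) = 0 := by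
    have h4 := mvfderiv_vlift (hF.mdifferentiableAt_fundTensor hw hWx hZx') v
      (hF.hasDerivAt_fundTensor_line hw v (W x) (Z x))
    have h5 : cartanTensor F w v (W x) (Z x) = 0 := hF.cartanTensor_base_middle hw v (Z x)
    rw [h5, mul_zero] at h4
    exact h4
  rw [nablaFund, hXw, h3] at h2
  have h6 : fundTensor F w (W x) (nabla (pullField Z) w (vlift w v))
      = fundTensor F w (nabla (pullField Z) w (vlift w v)) (W x) := hF.fundTensor_comm hw _ _
  have h7 : (0 : ℝ) - fundTensor F w (nabla (pullField W) w (vlift w v)) (Z x)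
      - fundTensor F w (W x) (nabla (pullField Z) w (vlift w v)) = 0 := h2
  have h8 : fundTensor F w (nabla (pullField W) w (vlift w v)) (Z x)
      = fundTensor F w (nabla (pullField Z) w (vlift w v)) (W x) := h1
  apply hF.eq_zero_of_fundTensor_self hw
  rw [hZx] at h7 h8
  linarith

lemma smoothFieldOn_zero (Ω : Set (TangentBundle 𝓘(ℝ, E) M)) :
    SmoothFieldOn 𝓘(ℝ, E).tangent (0 : FieldTM E M) Ω :=
  (contMDiff_zeroSection ℝ
    (TangentSpace 𝓘(ℝ, E).tangent : TangentBundle 𝓘(ℝ, E) M → Type _)).contMDiffOn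

lemma IsFinslerMetric.nablaFund_zero (hF : IsFinslerMetric F) (hw : w ∈ slit E M)
    (Y Z : VertSection E M) : nablaFund F nabla 0 Y Z w = 0 := by
  have h1 : (0 : FieldTM E M) w = 0 := rfl
  rw [nablaFund, h1, map_zero, map_zero, hF.fundTensor_zero_left hw, hF.fundTensor_zero_right hw,
    dirDeriv, map_zero]
  simp

/-- For a connection as in `M4`, the metric is parallel in vertical directions. -/
lemma IsFinslerMetric.nablaFund_almostTangent_of_M4 (hF : IsFinslerMetric F)
    (hM : M4 F S nabla) (Ω : Set (TangentBundle 𝓘(ℝ, E) M)) (X : FieldTM E M)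
    (Y Z : VertSection E M) (hΩ : IsOpen Ω) (hsub : Ω ⊆ slit E M)
    (hX : SmoothFieldOn 𝓘(ℝ, E).tangent X Ω) (hY : Y.SmoothOn Ω) (hZ : Z.SmoothOn Ω)
    (w : TangentBundle 𝓘(ℝ, E) M) (hw : w ∈ Ω) :
    nablaFund F nabla (almostTangent X) Y Z w = 0 := by
  -- $\mathrm C'$ is defined by choice, so $\mathrm C'(0, \cdot, \cdot) = 0$ is not read off from
  -- linearity; it follows from the axiom itself at $X = 0$.
  have h0 := hM Ω 0 Y Z hΩ hsub (smoothFieldOn_zero Ω) hY hZ w hw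
  have h1 := hM Ω (almostTangent X) Y Z hΩ hsub (SmoothFieldOn.almostTangent hX hΩ) hY hZ w hw
  have h2 : dproj w ((0 : FieldTM E M) w) = 0 := map_zero _
  simp only [h2] at h0
  have h3 : dproj w (almostTangent X w) = 0 := dproj_vlift w _
  simp only [h3] at h1
  rw [h1, ← h0, hF.nablaFund_zero (hsub hw)]

/-- The covariant derivative of `g_W` with respect to `D^W`. -/
lemma IsSemispray.covDerivFund_eq (hF : IsFinslerMetric F) (hS : IsSemispray S)
    (h : IsLift S nabla) (hO : IsOpen O) (hW : SmoothFieldOn 𝓘(ℝ, E) W O)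
    (hW0 : ∀ x ∈ O, W x ≠ 0)
    (hv : ∀ x ∈ O, ∀ v, nabla (pullField W) ⟨x, W x⟩ (vlift ⟨x, W x⟩ v) = 0)
    (hT : SmoothFieldOn 𝓘(ℝ, E) T O) (hV : SmoothFieldOn 𝓘(ℝ, E) V O) (hx : x ∈ O) :
    covDerivFund F (affineFamily S nabla W) W U T V x
      = nablaFund F nabla (hliftField S U) (pullField T) (pullField V) ⟨x, W x⟩
        + 2 * cartanTensor F ⟨x, W x⟩ (affineFamily S nabla W W x (U x)) (T x) (V x) := by
  have hw : (⟨x, W x⟩ : TangentBundle 𝓘(ℝ, E) M) ∈ slit E M := hW0 x hx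
  have hWx := hW.smoothFieldAt hO hx
  have hd : MDifferentiableAt 𝓘(ℝ, E).tangent 𝓘(ℝ, ℝ)
      (fun z : TangentBundle 𝓘(ℝ, E) M => fundTensor F z (T z.proj) (V z.proj)) ⟨x, W x⟩ :=
    hF.mdifferentiableAt_fundTensor hw (hT.smoothFieldAt hO hx) (hV.smoothFieldAt hO hx)
  have h1 := dirDeriv_sectionDeriv hWx hd (U x)
  -- Splitting $W_*U$ into $U^{\mathfrak h}$ and $i_w(D^W_UW)$ separates the derivative of $g$ into
  -- the horizontal term and the Cartan term.
  rw [hS.sectionDeriv_eq h hWx hw (hv x hx), map_add,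
    mvfderiv_vlift hd _ (hF.hasDerivAt_fundTensor_line hw _ (T x) (V x))] at h1
  rw [covDerivFund, dirDeriv]
  refine (congrArg (fun a : ℝ => a - _ - _) h1).trans ?_
  simp only [nablaFund, dirDeriv]
  change _ + _ - _ - _ = mvfderiv 𝓘(ℝ, E).tangent
    (fun z : TangentBundle 𝓘(ℝ, E) M => fundTensor F z (T z.proj) (V z.proj)) ⟨x, W x⟩
      (hlift S ⟨x, W x⟩ (U x))
    - fundTensor F ⟨x, W x⟩ (affineFamily S nabla W T x (U x)) (V x)
    - fundTensor F ⟨x, W x⟩ (T x) (affineFamily S nabla W V x (U x)) + _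
  ring

/-- An affine connection with prescribed torsion is determined by the derivative of `g_W`. -/
lemma IsFinslerMetric.agreeOn_of_metric (hF : IsFinslerMetric F)
    (hW : SmoothFieldOn 𝓘(ℝ, E) W O) (hW0 : ∀ x ∈ O, W x ≠ 0)
    {D D' : AffineOperator E M} (hD : IsAffineConnectionOn O D) (hD' : IsAffineConnectionOn O D')
    (hO : IsOpen O) (ht : IsTorsionFreeOn O D) (ht' : IsTorsionFreeOn O D')
    (a : (U T V : Π x : M, TangentSpace 𝓘(ℝ, E) x) → M → ℝ)
    (hm : ∀ U T V : Π x : M, TangentSpace 𝓘(ℝ, E) x, SmoothFieldOn 𝓘(ℝ, E) U O →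
      SmoothFieldOn 𝓘(ℝ, E) T O → SmoothFieldOn 𝓘(ℝ, E) V O → ∀ x ∈ O,
      covDerivFund F D W U T V x
        = 2 * cartanTensor F ⟨x, W x⟩ (D W x (U x)) (T x) (V x) - a U T V x)
    (hm' : ∀ U T V : Π x : M, TangentSpace 𝓘(ℝ, E) x, SmoothFieldOn 𝓘(ℝ, E) U O →
      SmoothFieldOn 𝓘(ℝ, E) T O → SmoothFieldOn 𝓘(ℝ, E) V O → ∀ x ∈ O,
      covDerivFund F D' W U T V x
        = 2 * cartanTensor F ⟨x, W x⟩ (D' W x (U x)) (T x) (V x) - a U T V x) :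
    AgreeOn O D D' := by
  set Δ : (U T : Π x : M, TangentSpace 𝓘(ℝ, E) x) → Π x : M, TangentSpace 𝓘(ℝ, E) x :=
    fun U T x => D T x (U x) - D' T x (U x) with hΔ
  have smΔ : ∀ U T, SmoothFieldOn 𝓘(ℝ, E) U O → SmoothFieldOn 𝓘(ℝ, E) T O →
      SmoothFieldOn 𝓘(ℝ, E) (Δ U T) O := fun U T hU hT =>
    ContMDiffOn.sub_section (hD.smooth O U T hO subset_rfl hU hT)
      (hD'.smooth O U T hO subset_rfl hU hT)
  have symΔ : ∀ U T, SmoothFieldOn 𝓘(ℝ, E) U O → SmoothFieldOn 𝓘(ℝ, E) T O → ∀ x ∈ O,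
      Δ U T x = Δ T U x := fun U T hU hT x hx => by
    have h1 := (ht U T hU hT x hx).trans (ht' U T hU hT x hx).symm
    simp only [hΔ]
    rw [sub_eq_sub_iff_add_eq_add] at h1 ⊢
    rw [h1, add_comm]
  set B : (U T V : Π x : M, TangentSpace 𝓘(ℝ, E) x) → M → ℝ :=
    fun U T V x => fundTensor F ⟨x, W x⟩ (Δ U T x) (V x) with hB
  set K : (U T V : Π x : M, TangentSpace 𝓘(ℝ, E) x) → M → ℝ :=
    fun U T V x => cartanTensor F ⟨x, W x⟩ (Δ U W x) (T x) (V x) with hK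
  -- Subtracting the two metric identities removes both the derivative of $g_W$ and the common term
  -- `a`.
  have hsum : ∀ U T V, SmoothFieldOn 𝓘(ℝ, E) U O → SmoothFieldOn 𝓘(ℝ, E) T O →
      SmoothFieldOn 𝓘(ℝ, E) V O → ∀ x ∈ O, B U T V x + B U V T x = -2 * K U T V x := by
    intro U T V hU hT hV x hx
    have hw : (⟨x, W x⟩ : TangentBundle 𝓘(ℝ, E) M) ∈ slit E M := hW0 x hx
    have h1 := hm U T V hU hT hV x hx
    have h2 := hm' U T V hU hT hV x hx
    have e1 : B U T V x = fundTensor F ⟨x, W x⟩ (D T x (U x)) (V x)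
        - fundTensor F ⟨x, W x⟩ (D' T x (U x)) (V x) := hF.fundTensor_sub_left hw _ _ _
    have e2 : B U V T x = fundTensor F ⟨x, W x⟩ (D V x (U x)) (T x)
        - fundTensor F ⟨x, W x⟩ (D' V x (U x)) (T x) := hF.fundTensor_sub_left hw _ _ _
    have e3 : K U T V x = cartanTensor F ⟨x, W x⟩ (D W x (U x)) (T x) (V x)
        - cartanTensor F ⟨x, W x⟩ (D' W x (U x)) (T x) (V x) :=
      hF.cartanTensor_sub_left hw _ _ _ _
    have e4 : fundTensor F ⟨x, W x⟩ (T x) (D V x (U x))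
      = fundTensor F ⟨x, W x⟩ (D V x (U x)) (T x) := hF.fundTensor_comm hw _ _
    have e5 : fundTensor F ⟨x, W x⟩ (T x) (D' V x (U x))
      = fundTensor F ⟨x, W x⟩ (D' V x (U x)) (T x) := hF.fundTensor_comm hw _ _
    rw [covDerivFund] at h1 h2
    linarith
  -- The usual cyclic combination of `hsum`, using that $B$ is symmetric in its first two arguments.
  have koszul : ∀ U T V, SmoothFieldOn 𝓘(ℝ, E) U O → SmoothFieldOn 𝓘(ℝ, E) T O →
      SmoothFieldOn 𝓘(ℝ, E) V O → ∀ x ∈ O,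
      B U T V x = K V U T x - K U T V x - K T U V x := by
    intro U T V hU hT hV x hx
    have s : ∀ U T V, SmoothFieldOn 𝓘(ℝ, E) U O → SmoothFieldOn 𝓘(ℝ, E) T O →
        B U T V x = B T U V x := fun U T V hU hT => by
      simp only [hB, symΔ U T hU hT x hx]
    have h1 := hsum U T V hU hT hV x hx
    have h2 := hsum T U V hT hU hV x hx
    have h3 := hsum V U T hV hU hT x hx
    have s1 := s U T V hU hT
    have s2 := s U V T hU hV
    have s3 := s T V U hT hV
    linarith
  -- $\Delta(U, T)$ is itself a smooth field on $O$, hence an admissible third argument; no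
  -- extension of vectors is needed.
  have zero_of : ∀ U T, SmoothFieldOn 𝓘(ℝ, E) U O → SmoothFieldOn 𝓘(ℝ, E) T O → ∀ x ∈ O,
      B U T (Δ U T) x = 0 → Δ U T x = 0 := fun U T _ _ x hx h =>
    hF.eq_zero_of_fundTensor_self (w := ⟨x, W x⟩) (hW0 x hx) h
  have KW2 : ∀ U V, ∀ x ∈ O, K U W V x = 0 := fun U V x hx =>
    hF.cartanTensor_base_middle (w := ⟨x, W x⟩) (hW0 x hx) _ _
  have KW3 : ∀ U V, ∀ x ∈ O, K U V W x = 0 := fun U V x hx =>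
    hF.cartanTensor_base_right (w := ⟨x, W x⟩) (hW0 x hx) _ _
  have K0 : ∀ U T V, ∀ x ∈ O, Δ U W x = 0 → K U T V x = 0 := fun U T V x hx h => by
    simp only [hK, h]
    exact hF.cartanTensor_zero_left (w := ⟨x, W x⟩) (hW0 x hx) _ _
  -- With $U = T = W$ every Cartan term has $W$ among its last two arguments. For $\Delta(U, W)$
  -- below, the one remaining term contains $\Delta(W, W)$.
  have hWW : ∀ x ∈ O, Δ W W x = 0 := fun x hx => by
    refine zero_of W W hW hW x hx ?_
    rw [koszul W W _ hW hW (smΔ W W hW hW) x hx, KW2 _ _ x hx, KW2 _ _ x hx]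
    simp
  have hUW : ∀ U, SmoothFieldOn 𝓘(ℝ, E) U O → ∀ x ∈ O, Δ U W x = 0 := fun U hU x hx => by
    refine zero_of U W hU hW x hx ?_
    rw [koszul U W _ hU hW (smΔ U W hU hW) x hx, KW3 _ _ x hx, KW2 _ _ x hx,
      K0 _ _ _ x hx (hWW x hx)]
    simp
  intro U T hU hT x hx
  refine sub_eq_zero.1 (zero_of U T hU hT x hx ?_)
  have hsm := smΔ U T hU hT
  rw [koszul U T _ hU hT hsm x hx, K0 _ _ _ x hx (hUW _ hsm x hx), K0 _ _ _ x hx (hUW _ hU x hx),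
    K0 _ _ _ x hx (hUW _ hT x hx)]
  simp

end MetricProperties

/-! ### The four classical connections and their families -/

section Families

variable {E : Type*} [NormedAddCommGroup E] [NormedSpace ℝ E] [FiniteDimensional ℝ E]
  {M : Type*} [TopologicalSpace M] [T2Space M] [ChartedSpace E M] [IsManifold 𝓘(ℝ, E) ∞ M]
  {F : TangentBundle 𝓘(ℝ, E) M → ℝ} {w : TangentBundle 𝓘(ℝ, E) M} {S : FieldTM E M}
  {nabla : VertOperator E M} {O : Set M} {U T V W : Π x : M, TangentSpace 𝓘(ℝ, E) x} {x : M}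

/-- The value of `∇ g` on the horizontal lift of `U` and the vertical lifts of `T` and `V`. -/
lemma IsSemispray.nablaFund_hliftField (hS : IsSemispray S)
    {A : FieldTM E M → VertSection E M → VertSection E M → TangentBundle 𝓘(ℝ, E) M → ℝ}
    (hA : NablaFundEq F nabla A) (hO : IsOpen O) (hU : SmoothFieldOn 𝓘(ℝ, E) U O)
    (hT : SmoothFieldOn 𝓘(ℝ, E) T O) (hV : SmoothFieldOn 𝓘(ℝ, E) V O) (hw : w ∈ slitOver O) :
    nablaFund F nabla (hliftField S U) (pullField T) (pullField V) w
      = A (hliftField S U) (pullField T) (pullField V) w :=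
  hA _ _ _ _ (isOpen_slitOver hO) (fun _ hz => hz.2) (hS.smoothFieldOn_hliftField hO hU)
    (smoothOn_pullField hT) (smoothOn_pullField hV) w hw

lemma IsSemispray.verPart_hliftField (hS : IsSemispray S) (hO : IsOpen O)
    (hU : SmoothFieldOn 𝓘(ℝ, E) U O) (hw : w ∈ slitOver O) :
    verPart S (hliftField S U) w = 0 := by
  rw [hS.verPart_eq hw.2 ((hS.smoothFieldOn_hliftField hO hU).smoothFieldAt
    (isOpen_slitOver hO) hw), hS.dproj_hliftField hw.2]
  exact sub_self _

/-- A lift of `Γ_S` whose vertical derivatives of `W^v` vanish along `W` and whose metric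
derivative in horizontal directions is zero induces an affine connection of Cartan type. -/
lemma IsSemispray.isCartanChernRundType (hF : IsFinslerMetric F) (hS : IsSemispray S)
    (h : IsLift S nabla) (ht : T2 S nabla ∨ T3 nabla) (hO : IsOpen O)
    (hW : SmoothFieldOn 𝓘(ℝ, E) W O) (hW0 : ∀ x ∈ O, W x ≠ 0)
    (hv : ∀ x ∈ O, ∀ v, nabla (pullField W) ⟨x, W x⟩ (vlift ⟨x, W x⟩ v) = 0)
    (hm : ∀ U T V : Π x : M, TangentSpace 𝓘(ℝ, E) x, SmoothFieldOn 𝓘(ℝ, E) U O →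
      SmoothFieldOn 𝓘(ℝ, E) T O → SmoothFieldOn 𝓘(ℝ, E) V O → ∀ w ∈ slitOver O,
      nablaFund F nabla (hliftField S U) (pullField T) (pullField V) w = 0) :
    IsCartanChernRundType F O W (affineFamily S nabla W) where
  affine := hS.isAffineConnectionOn h.connection hW hW0
  torsionFree := hS.isTorsionFreeOn h.connection ht hO hW0
  metric U T V hU hT hV x hx := by
    rw [hS.covDerivFund_eq hF h hO hW hW0 hv hT hV hx,
      hm U T V hU hT hV _ (sectionMap_mem_slitOver hx hW0), zero_add]

/-- A lift of `Γ_S` whose vertical derivatives of `W^v` vanish along `W` and whose metric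
derivative in horizontal directions is `-2 C'` induces an affine connection of Berwald type. -/
lemma IsSemispray.isBerwaldHashiguchiType (hF : IsFinslerMetric F) (hS : IsSemispray S)
    (h : IsLift S nabla) (ht : T2 S nabla ∨ T3 nabla) (hO : IsOpen O)
    (hW : SmoothFieldOn 𝓘(ℝ, E) W O) (hW0 : ∀ x ∈ O, W x ≠ 0)
    (hv : ∀ x ∈ O, ∀ v, nabla (pullField W) ⟨x, W x⟩ (vlift ⟨x, W x⟩ v) = 0)
    (hm : ∀ U T V : Π x : M, TangentSpace 𝓘(ℝ, E) x, SmoothFieldOn 𝓘(ℝ, E) U O →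
      SmoothFieldOn 𝓘(ℝ, E) T O → SmoothFieldOn 𝓘(ℝ, E) V O → ∀ w ∈ slitOver O,
      nablaFund F nabla (hliftField S U) (pullField T) (pullField V) w
        = -2 * landsbergTensor F S w (U w.proj) (T w.proj) (V w.proj)) :
    IsBerwaldHashiguchiType F S O W (affineFamily S nabla W) where
  affine := hS.isAffineConnectionOn h.connection hW hW0
  torsionFree := hS.isTorsionFreeOn h.connection ht hO hW0
  metric U T V hU hT hV x hx := by
    rw [hS.covDerivFund_eq hF h hO hW hW0 hv hT hV hx,
      hm U T V hU hT hV _ (sectionMap_mem_slitOver hx hW0)]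
    ring

lemma IsCartan.isCartanChernRundType (hF : IsFinslerMetric F) (hS : IsSemispray S)
    (h : IsCartan F S nabla) (hO : IsOpen O) (hW : SmoothFieldOn 𝓘(ℝ, E) W O)
    (hW0 : ∀ x ∈ O, W x ≠ 0) : IsCartanChernRundType F O W (affineFamily S nabla W) := by
  obtain ⟨hl, h2, h6, h7⟩ := h
  refine hS.isCartanChernRundType hF hl (.inl h2) hO hW hW0 ?_ ?_
  · exact fun x hx v => hS.nabla_vlift_of_M7 hF hl.connection h7
      (fun Ω X Y Z hΩ hsub hX hY hZ w hw => h6 Ω _ Y Z hΩ hsub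
        (SmoothFieldOn.almostTangent hX hΩ) hY hZ w hw) hO hW hW0 hx v
  · exact fun U T V hU hT hV w hw => hS.nablaFund_hliftField h6 hO hU hT hV hw

/-- Horizontal lifts have no vertical part, so $\mathrm C(\mathscr VX, \cdot, \cdot)$ contributes
nothing along them and $g$ is horizontally parallel, just as for the Cartan connection. -/
lemma IsChernRund.isCartanChernRundType (hF : IsFinslerMetric F) (hS : IsSemispray S)
    (h : IsChernRund F S nabla) (hO : IsOpen O) (hW : SmoothFieldOn 𝓘(ℝ, E) W O)
    (hW0 : ∀ x ∈ O, W x ≠ 0) : IsCartanChernRundType F O W (affineFamily S nabla W) := by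
  obtain ⟨hl, h3, hm⟩ := h
  refine hS.isCartanChernRundType hF hl (.inr h3) hO hW hW0 ?_ ?_
  · exact fun x hx v => hS.nabla_vlift_of_T3 hl.connection h3 hO hW
      (sectionMap_mem_slitOver hx hW0) v
  · intro U T V hU hT hV w hw
    rw [hS.nablaFund_hliftField hm hO hU hT hV hw, hS.verPart_hliftField hO hU hw, vliftInv_zero,
      hF.cartanTensor_zero_left hw.2, mul_zero]

lemma IsBerwald.isBerwaldHashiguchiType (hF : IsFinslerMetric F) (hS : IsSemispray S)
    (h : IsBerwald F S nabla) (hO : IsOpen O) (hW : SmoothFieldOn 𝓘(ℝ, E) W O)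
    (hW0 : ∀ x ∈ O, W x ≠ 0) : IsBerwaldHashiguchiType F S O W (affineFamily S nabla W) := by
  obtain ⟨hl, h3, hm⟩ := h
  refine hS.isBerwaldHashiguchiType hF hl (.inr h3) hO hW hW0 ?_ ?_
  · exact fun x hx v => hS.nabla_vlift_of_T3 hl.connection h3 hO hW
      (sectionMap_mem_slitOver hx hW0) v
  · intro U T V hU hT hV w hw
    rw [hS.nablaFund_hliftField hm hO hU hT hV hw, hS.verPart_hliftField hO hU hw, vliftInv_zero,
      hF.cartanTensor_zero_left hw.2, hS.dproj_hliftField hw.2, mul_zero, zero_sub, neg_mul]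
    rfl

lemma IsHashiguchi.isBerwaldHashiguchiType (hF : IsFinslerMetric F) (hS : IsSemispray S)
    (h : IsHashiguchi F S nabla) (hO : IsOpen O) (hW : SmoothFieldOn 𝓘(ℝ, E) W O)
    (hW0 : ∀ x ∈ O, W x ≠ 0) : IsBerwaldHashiguchiType F S O W (affineFamily S nabla W) := by
  obtain ⟨hl, h2, h4, h7⟩ := h
  refine hS.isBerwaldHashiguchiType hF hl (.inl h2) hO hW hW0 ?_ ?_
  · exact fun x hx v => hS.nabla_vlift_of_M7 hF hl.connection h7
      (hF.nablaFund_almostTangent_of_M4 h4) hO hW hW0 hx v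
  · intro U T V hU hT hV w hw
    rw [hS.nablaFund_hliftField h4 hO hU hT hV hw, hS.dproj_hliftField hw.2]
    rfl

lemma IsCartanChernRundType.agreeOn (hF : IsFinslerMetric F) (hO : IsOpen O)
    (hW : SmoothFieldOn 𝓘(ℝ, E) W O) (hW0 : ∀ x ∈ O, W x ≠ 0) {D D' : AffineOperator E M}
    (h : IsCartanChernRundType F O W D) (h' : IsCartanChernRundType F O W D') :
    AgreeOn O D D' :=
  hF.agreeOn_of_metric hW hW0 h.affine h'.affine hO h.torsionFree h'.torsionFree
    (fun _ _ _ _ => 0)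
    (fun U T V hU hT hV x hx => (h.metric U T V hU hT hV x hx).trans (sub_zero _).symm)
    (fun U T V hU hT hV x hx => (h'.metric U T V hU hT hV x hx).trans (sub_zero _).symm)

/-- $\mathrm C'$ does not involve the connection being determined, so it plays the role of the
common term and cancels; none of its properties is needed. -/
lemma IsBerwaldHashiguchiType.agreeOn (hF : IsFinslerMetric F) (hO : IsOpen O)
    (hW : SmoothFieldOn 𝓘(ℝ, E) W O) (hW0 : ∀ x ∈ O, W x ≠ 0) {D D' : AffineOperator E M}
    (h : IsBerwaldHashiguchiType F S O W D) (h' : IsBerwaldHashiguchiType F S O W D') :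
    AgreeOn O D D' :=
  hF.agreeOn_of_metric hW hW0 h.affine h'.affine hO h.torsionFree h'.torsionFree
    (fun U T V x => 2 * landsbergTensor F S ⟨x, W x⟩ (U x) (T x) (V x)) h.metric h'.metric

end Families

end Finsler

end

theorem mainTheorem5
    {E : Type*} [NormedAddCommGroup E] [NormedSpace ℝ E] [FiniteDimensional ℝ E]
    {M : Type*} [TopologicalSpace M] [T2Space M] [ChartedSpace E M] [IsManifold 𝓘(ℝ, E) ∞ M]
    (F : TangentBundle 𝓘(ℝ, E) M → ℝ) (hF : Finsler.IsFinslerMetric F)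
    (S : Finsler.FieldTM E M) (hS : Finsler.IsGeodesicSpray F S) :
    (∀ nabla : Finsler.VertOperator E M,
      Finsler.IsCartan F S nabla ∨ Finsler.IsChernRund F S nabla →
      ∀ (O : Set M) (W : Π x : M, TangentSpace 𝓘(ℝ, E) x), IsOpen O →
        Finsler.SmoothFieldOn 𝓘(ℝ, E) W O → (∀ x ∈ O, W x ≠ 0) →
        Finsler.IsCartanChernRundType F O W (Finsler.affineFamily S nabla W)) ∧
    (∀ nabla : Finsler.VertOperator E M,
      Finsler.IsBerwald F S nabla ∨ Finsler.IsHashiguchi F S nabla →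
      ∀ (O : Set M) (W : Π x : M, TangentSpace 𝓘(ℝ, E) x), IsOpen O →
        Finsler.SmoothFieldOn 𝓘(ℝ, E) W O → (∀ x ∈ O, W x ≠ 0) →
        Finsler.IsBerwaldHashiguchiType F S O W (Finsler.affineFamily S nabla W)) ∧
    (∀ (O : Set M) (W : Π x : M, TangentSpace 𝓘(ℝ, E) x), IsOpen O →
      Finsler.SmoothFieldOn 𝓘(ℝ, E) W O → (∀ x ∈ O, W x ≠ 0) →
      ∀ D D' : Finsler.AffineOperator E M,
        (Finsler.IsCartanChernRundType F O W D → Finsler.IsCartanChernRundType F O W D' →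
          Finsler.AgreeOn O D D') ∧
        (Finsler.IsBerwaldHashiguchiType F S O W D → Finsler.IsBerwaldHashiguchiType F S O W D' →
          Finsler.AgreeOn O D D')) ∧
    (∀ nabla nabla' : Finsler.VertOperator E M,
      (Finsler.IsCartan F S nabla ∧ Finsler.IsChernRund F S nabla') ∨
        (Finsler.IsBerwald F S nabla ∧ Finsler.IsHashiguchi F S nabla') →
      ∀ (O : Set M) (W : Π x : M, TangentSpace 𝓘(ℝ, E) x), IsOpen O →
        Finsler.SmoothFieldOn 𝓘(ℝ, E) W O → (∀ x ∈ O, W x ≠ 0) →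
        Finsler.AgreeOn O (Finsler.affineFamily S nabla W) (Finsler.affineFamily S nabla' W)) := by
  have hS' := hS.isSemispray
  have h1 : ∀ nabla : Finsler.VertOperator E M,
      Finsler.IsCartan F S nabla ∨ Finsler.IsChernRund F S nabla →
      ∀ (O : Set M) (W : Π x : M, TangentSpace 𝓘(ℝ, E) x), IsOpen O →
        Finsler.SmoothFieldOn 𝓘(ℝ, E) W O → (∀ x ∈ O, W x ≠ 0) →
        Finsler.IsCartanChernRundType F O W (Finsler.affineFamily S nabla W) := by
    rintro nabla (h | h) O W hO hW hW0
    · exact h.isCartanChernRundType hF hS' hO hW hW0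
    · exact h.isCartanChernRundType hF hS' hO hW hW0
  have h2 : ∀ nabla : Finsler.VertOperator E M,
      Finsler.IsBerwald F S nabla ∨ Finsler.IsHashiguchi F S nabla →
      ∀ (O : Set M) (W : Π x : M, TangentSpace 𝓘(ℝ, E) x), IsOpen O →
        Finsler.SmoothFieldOn 𝓘(ℝ, E) W O → (∀ x ∈ O, W x ≠ 0) →
        Finsler.IsBerwaldHashiguchiType F S O W (Finsler.affineFamily S nabla W) := by
    rintro nabla (h | h) O W hO hW hW0
    · exact h.isBerwaldHashiguchiType hF hS' hO hW hW0
    · exact h.isBerwaldHashiguchiType hF hS' hO hW hW0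
  refine ⟨h1, h2, fun O W hO hW hW0 D D' =>
    ⟨fun h h' => h.agreeOn hF hO hW hW0 h', fun h h' => h.agreeOn hF hO hW hW0 h'⟩, ?_⟩
  rintro nabla nabla' (⟨h, h'⟩ | ⟨h, h'⟩) O W hO hW hW0
  · exact (h1 nabla (.inl h) O W hO hW hW0).agreeOn hF hO hW hW0
      (h1 nabla' (.inr h') O W hO hW hW0)
  · exact (h2 nabla (.inl h) O W hO hW hW0).agreeOn hF hO hW hW0
      (h2 nabla' (.inr h') O W hO hW hW0)
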